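/- Conventions. A graph is a finite connected nonempty multigraph, loops allowed. An edge-weighted graph $(G,l)$ is a graph with a length function $l:E(G)\to\mathbb R_{>0}\cup\{\infty\}$, where $l(e)=\infty$ is allowed only if $e$ is a leaf edge; such an edge is identified with $[0,\infty]$, its end at $\infty$ being a vertex of valence one. A tropical curve is the $\infty$-metric space $\Gamma$ obtained from an edge-weighted graph $(G,l)$ (with the path metric, and with the usual topology of $[0,\infty]$ near points at infinity), and $(G,l)$ is called a model of $\Gamma$. An isometry of $\Gamma$ is a self-homeomorphism preserving the distance. A continuous map $\varphi:\Gamma\to\Gamma'$ is a morphism if, for some models $(G,l)$ and $(G',l')$, it maps $V(G)$ into $V(G')$, the preimage of the relative interior of every edge of $G'$ is a union of relative interiors of edges of $G$, and on each edge $e$ of $G$ it is a dilation by an integer $\deg_e(\varphi)\ge 0$; it is finite if $\deg_e(\varphi)>0$ for all $e$. A half-edge of a point $x$ is a (germ of a) connected component $h$ of $U_x\setminus\{x\}$ for small connected neighbourhoods $U_x$ of $x$, and $\deg_h(\varphi):=\deg_e(\varphi)$ if $h$ lies in the edge $e$. If $\Gamma'$ is not a singleton, $\varphi$ is harmonic if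 for every $x\in\Gamma$ the number $\deg_x(\varphi):=\sum_{h\mapsto h'}\deg_h(\varphi)$, summed over the half-edges $h$ of $x$ mapped to $h'$, does not depend on the half-edge $h'$ of $\varphi(x)$. A finite harmonic morphism has degree $n$ if $\sum_{x\in\varphi^{-1}(x')}\deg_x(\varphi)=n$ for every $x'\in\Gamma'$. Statement. Let $\Gamma$ be a tropical curve that is not a singleton and let $K$ be a finite subgroup of the isometry group of $\Gamma$. There is a model $(G_1,l_1)$ of $\Gamma$ whose vertex set is $K$-stable and such that the two ends of every edge lie in different $K$-orbits (so that neither $G_1$ nor the quotient graph $G'=G_1/K$, with vertices $V(G_1)/K$ and edges $E(G_1)/K$, has loops). For every such model, the function $l'([e])=|K_e|\cdot l_1(e)$, where $K_e$ is the stabilizer of the edge $e$ in $K$, is well defined on $E(G')$ and $(G',l')$ is an edge-weighted graph. Let $\Gamma'$ be the tropical curve obtained from it. Then there is exactly one map $\varphi:\Gamma\to\Gamma'$ that sends each vertex $v$ of $G_1$ to $[v]$ and each edge $e$ of $G_1$ to $[e]$, linearly with factor $|K_e|$ and compatibly with the ends. The fibres of $\varphi$ are exactly the $K$-orbits, and $\varphi$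 is a finite harmonic morphism of degree $|K|$, with $\deg_e(\varphi)=|K_e|$ for every edge $e$ of $G_1$. -/

import Mathlib

open Set Filter Topology
open scoped ENNReal

/-- The raw data of a finite multigraph (loops and parallel edges allowed) with edge lengths in
`[0, ∞]`. Every edge carries a reference orientation `src e ⟶ tgt e`, which only serves to
parametrize it by `[0, len e]`. The usual requirements are collected in `IsTropical`. -/
structure WeightedGraph where
  V : Type
  E : Type
  finite_V : Finite V
  finite_E : Finite E
  src : E → V
  tgt : E → V
  len : E → ℝ≥0∞

attribute [instance] WeightedGraph.finite_V WeightedGraph.finite_E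

namespace WeightedGraph

variable (G : WeightedGraph)

/-- `G` is an edge-weighted graph: nonempty, connected, with positive lengths, where the length `∞`
occurs only on leaf edges. An edge of infinite length is `[0, ∞]`, and it is its end `tgt e`,
a vertex of valence one, that lies at infinity. -/
structure IsTropical : Prop where
  nonempty : Nonempty G.V
  connected : ∀ u v : G.V, Relation.EqvGen (fun a b => ∃ e, G.src e = a ∧ G.tgt e = b) u v
  len_pos : ∀ e, 0 < G.len e
  not_loop_of_top : ∀ e, G.len e = ∞ → G.src e ≠ G.tgt e
  leaf_of_top : ∀ e, G.len e = ∞ → ∀ f, G.src f = G.tgt e ∨ G.tgt f = G.tgt e → f = e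

/-- The disjoint union of the vertices and of the closed intervals `[0, len e]`. -/
abbrev PrePoint : Type := G.V ⊕ (Σ e : G.E, Set.Iic (G.len e))

/-- Glue the endpoint `0` of `[0, len e]` to `src e` and the endpoint `len e` to `tgt e`. -/
inductive Glue : G.PrePoint → G.PrePoint → Prop
  | src (e : G.E) : Glue (Sum.inr ⟨e, ⟨0, Set.mem_Iic.2 bot_le⟩⟩) (Sum.inl (G.src e))
  | tgt (e : G.E) : Glue (Sum.inr ⟨e, ⟨G.len e, Set.mem_Iic.2 le_rfl⟩⟩) (Sum.inl (G.tgt e))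

/-- The set of points of the tropical curve obtained from `G`. -/
def Curve : Type := Quot G.Glue

/-- The quotient topology. The intervals `[0, len e]` have the usual topology of `[0, ∞]`, so
that points at infinity are limits of finite points; the vertex set is discrete. -/
instance : TopologicalSpace G.Curve :=
  letI : TopologicalSpace G.V := ⊥
  inferInstanceAs (TopologicalSpace (Quot G.Glue))

/-- The point of the curve given by a vertex. -/
def vertex (v : G.V) : G.Curve := Quot.mk _ (Sum.inl v)

/-- The point at distance `t` from `src e` along `e`, for `t ≤ len e`
(for larger `t`, the end `tgt e`). -/
noncomputable def pt (e : G.E) (t : ℝ≥0∞) : G.Curve :=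
  Quot.mk _ (Sum.inr ⟨e, ⟨min t (G.len e), Set.mem_Iic.2 (min_le_right _ _)⟩⟩)

end WeightedGraph

/-- The distance `|s - t|` of two points of `[0, ∞]`; the point `∞` is at distance `∞` from all the
others and at distance `0` from itself. -/
noncomputable def segLength (s t : ℝ≥0∞) : ℝ≥0∞ := (s - t) + (t - s)

namespace WeightedGraph

variable (G : WeightedGraph)

/-- `ChainLength x y r`: one can travel from `x` to `y` through finitely many segments, each of them
contained in an edge, of total length `r`. -/
inductive ChainLength : G.Curve → G.Curve → ℝ≥0∞ → Prop
  | refl (x : G.Curve) : ChainLength x x 0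
  | step (e : G.E) (s t : ℝ≥0∞) (y : G.Curve) (r : ℝ≥0∞) (hs : s ≤ G.len e) (ht : t ≤ G.len e)
      (h : ChainLength (G.pt e t) y r) : ChainLength (G.pt e s) y (segLength s t + r)

/-- The path metric, with values in `[0, ∞]`. -/
noncomputable instance : EDist G.Curve := ⟨fun x y => sInf {r | G.ChainLength x y r}⟩

end WeightedGraph

section Curves

universe u

/-- A model of `X`: an edge-weighted graph together with an identification of the tropical curve
obtained from it with `X`, as topological spaces with an extended distance. -/
structure Model (X : Type u) [TopologicalSpace X] [EDist X] where
  graph : WeightedGraph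
  isTropical : graph.IsTropical
  toHomeo : graph.Curve ≃ₜ X
  edist_eq : ∀ a b, edist (toHomeo a) (toHomeo b) = edist a b

/-- `X` is a tropical curve. -/
def IsTropicalCurve (X : Type u) [TopologicalSpace X] [EDist X] : Prop := Nonempty (Model X)

/-- The edge-weighted graph `G`, as a model of the tropical curve obtained from it. -/
def WeightedGraph.selfModel (G : WeightedGraph) (hG : G.IsTropical) : Model G.Curve where
  graph := G
  isTropical := hG
  toHomeo := Homeomorph.refl _
  edist_eq _ _ := rfl

/-- The isometry group of `X`: the homeomorphisms that preserve the distance. (Continuity is not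
automatic at points at infinity, which are at distance `∞` from all other points.) -/
def isometryGroup (X : Type u) [TopologicalSpace X] [EDist X] : Subgroup (X ≃ₜ X) where
  carrier := {σ | ∀ x y, edist (σ x) (σ y) = edist x y}
  one_mem' _ _ := rfl
  mul_mem' {a b} ha hb x y := (ha (b x) (b y)).trans (hb x y)
  inv_mem' {a} ha x y := by
    have h := ha (a⁻¹ x) (a⁻¹ y)
    have e : ∀ z, a (a⁻¹ z) = z := fun z => a.apply_symm_apply z
    rw [e, e] at h
    exact h.symm

namespace Model

variable {X : Type u} [TopologicalSpace X] [EDist X] (M : Model X)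

/-- A vertex, as a point of `X`. -/
def vertex (v : M.graph.V) : X := M.toHomeo (M.graph.vertex v)

/-- The point of `X` at distance `t` from the source along the edge `e`, for `t ≤ len e`. -/
noncomputable def pt (e : M.graph.E) (t : ℝ≥0∞) : X := M.toHomeo (M.graph.pt e t)

/-- An edge, as a closed subset of `X`. -/
def edgeSet (e : M.graph.E) : Set X := M.pt e '' Set.Icc 0 (M.graph.len e)

/-- The relative interior of an edge. -/
def relInterior (e : M.graph.E) : Set X := M.pt e '' Set.Ioo 0 (M.graph.len e)

/-- A half-edge of the point `x`: a position on an edge `edge` which is `x`, with a direction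
along this edge in which one can leave `x`. These are in bijection with the
connected components of `U ∖ {x}` for small connected neighbourhoods `U` of `x`. -/
structure HalfEdge (x : X) where
  edge : M.graph.E
  param : ℝ≥0∞
  param_le : param ≤ M.graph.len edge
  pt_eq : M.pt edge param = x
  forward : Bool
  leaves : if forward then param < M.graph.len edge else 0 < param

/-- The germ at `x` of a half-edge: the filter generated by its initial segments, which are the
components corresponding to `h` in `U ∖ {x}`, for smaller and smaller neighbourhoods `U`. -/
noncomputable def HalfEdge.germ {M : Model X} {x : X} (h : M.HalfEdge x) : Filter X :=
  Filter.map (M.pt h.edge) (if h.forward then 𝓝[>] h.param else 𝓝[<] h.param)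

end Model

section Morphisms

variable {X : Type u} [TopologicalSpace X] [EDist X]
variable {Y : Type*} [TopologicalSpace Y] [EDist Y]

/-- `φ` is a dilation on the edge `e` by the integer factor `k ≥ 0`: for `k = 0` it contracts `e` to
a point; otherwise it maps `e` into an edge of the target, multiplying by `k` the distances,
along the edges, of points that are not at infinity. -/
def IsDilationOn (M : Model X) (M' : Model Y) (φ : X → Y) (e : M.graph.E) (k : ℕ) : Prop :=
  (k = 0 → ∀ s t, s ≤ M.graph.len e → t ≤ M.graph.len e → φ (M.pt e s) = φ (M.pt e t)) ∧
  (k ≠ 0 → ∃ (e' : M'.graph.E) (f : ℝ≥0∞ → ℝ≥0∞),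
    (∀ t, t ≤ M.graph.len e → f t ≤ M'.graph.len e' ∧ φ (M.pt e t) = M'.pt e' (f t)) ∧
    ∀ s t, s ≤ M.graph.len e → t ≤ M.graph.len e → s ≠ ∞ → t ≠ ∞ →
      segLength (f s) (f t) = k * segLength s t)

/-- `φ` is a morphism of tropical curves, with respect to the models `M` and `M'`, with dilation
factors `d`. -/
structure IsMorphismWith (M : Model X) (M' : Model Y) (φ : X → Y) (d : M.graph.E → ℕ) : Prop where
  continuous : Continuous φ
  map_vertex : ∀ v, ∃ v', φ (M.vertex v) = M'.vertex v'
  preimage_relInterior : ∀ e', ∃ S : Set M.graph.E,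
    φ ⁻¹' M'.relInterior e' = ⋃ e ∈ S, M.relInterior e
  dilation : ∀ e, IsDilationOn M M' φ e (d e)

/-- The sum of the dilation factors over the half-edges `h` of `x` that `φ` maps to the half-edge
`h'` of `φ x` (a finite sum). -/
noncomputable def localDegree (M : Model X) (M' : Model Y) (φ : X → Y) (d : M.graph.E → ℕ) (x : X)
    (h' : M'.HalfEdge (φ x)) : ℕ :=
  ∑ᶠ h : {h : M.HalfEdge x // Tendsto φ h.germ h'.germ}, d h.1.edge

/-- `φ` is harmonic at `x`: the local degree is independent of the half-edge of `φ x`. -/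
def IsHarmonicAt (M : Model X) (M' : Model Y) (φ : X → Y) (d : M.graph.E → ℕ) (x : X) : Prop :=
  ∀ h₁ h₂ : M'.HalfEdge (φ x), localDegree M M' φ d x h₁ = localDegree M M' φ d x h₂

open Classical in
/-- The degree of `φ` at `x`: the common value of the local degrees, if `φ` is harmonic at `x`. (There
is a half-edge at every point as soon as the target is not a singleton.) -/
noncomputable def degreeAt (M : Model X) (M' : Model Y) (φ : X → Y) (d : M.graph.E → ℕ) (x : X) : ℕ :=
  if h : Nonempty (M'.HalfEdge (φ x)) then localDegree M M' φ d x h.some else 0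

/-- `φ` is a finite harmonic morphism of degree `n`, with respect to the models `M`, `M'`, with
dilation factors `d`. -/
structure IsFiniteHarmonicOfDegree (M : Model X) (M' : Model Y) (φ : X → Y) (d : M.graph.E → ℕ)
    (n : ℕ) : Prop where
  isMorphism : IsMorphismWith M M' φ d
  finite : ∀ e, 0 < d e
  harmonic : ∀ x, IsHarmonicAt M M' φ d x
  degree : ∀ y : Y, ∑ᶠ x : {x : X // φ x = y}, degreeAt M M' φ d x = n

end Morphisms

namespace Model

variable {X : Type u} [TopologicalSpace X] [EDist X] (M : Model X) (K : Subgroup (X ≃ₜ X))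

/-- Two vertices are equivalent if they lie in the same `K`-orbit. -/
def vertexSetoid : Setoid M.graph.V where
  r v w := ∃ σ ∈ K, σ (M.vertex v) = M.vertex w
  iseqv :=
    { refl := fun _ => ⟨1, K.one_mem, rfl⟩
      symm := by
        rintro v w ⟨σ, hσ, h⟩
        exact ⟨σ⁻¹, K.inv_mem hσ, by rw [← h]; exact σ.symm_apply_apply _⟩
      trans := by
        rintro u v w ⟨σ, hσ, h⟩ ⟨τ, hτ, h'⟩
        exact ⟨τ * σ, K.mul_mem hτ hσ, by rw [← h', ← h]; rfl⟩ }

/-- Two edges are equivalent if they lie in the same `K`-orbit. -/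
def edgeSetoid : Setoid M.graph.E where
  r e f := ∃ σ ∈ K, σ '' M.edgeSet e = M.edgeSet f
  iseqv :=
    { refl := fun _ => ⟨1, K.one_mem, Set.image_id _⟩
      symm := by
        rintro v w ⟨σ, hσ, h⟩
        refine ⟨σ⁻¹, K.inv_mem hσ, ?_⟩
        rw [← h, ← Set.image_comp]
        exact (Set.image_congr fun x _ => σ.symm_apply_apply x).trans (Set.image_id _)
      trans := by
        rintro u v w ⟨σ, hσ, h⟩ ⟨τ, hτ, h'⟩
        refine ⟨τ * σ, K.mul_mem hτ hσ, ?_⟩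
        rw [← h', ← h, ← Set.image_comp]
        rfl }

/-- The stabilizer `K_e` of the edge `e` in `K`. -/
def edgeStabilizer (e : M.graph.E) : Subgroup (X ≃ₜ X) where
  carrier := {σ | σ ∈ K ∧ σ '' M.edgeSet e = M.edgeSet e}
  one_mem' := ⟨K.one_mem, Set.image_id _⟩
  mul_mem' := by
    rintro a b ⟨ha, ha'⟩ ⟨hb, hb'⟩
    refine ⟨K.mul_mem ha hb, ?_⟩
    have h : (a * b : X ≃ₜ X) '' M.edgeSet e = a '' (b '' M.edgeSet e) := by
      rw [← Set.image_comp]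
      rfl
    rw [h, hb', ha']
  inv_mem' := by
    rintro a ⟨ha, ha'⟩
    refine ⟨K.inv_mem ha, ?_⟩
    conv_lhs => rw [← ha', ← Set.image_comp]
    exact (Set.image_congr fun x _ => a.symm_apply_apply x).trans (Set.image_id _)

/-- The quotient graph `G' = G / K`, with the length function `[e] ↦ |K_e| * len e`. The length and
the reference orientation of a class are read off on a representative of it. -/
noncomputable def quotientGraph : WeightedGraph where
  V := Quotient (M.vertexSetoid K)
  E := Quotient (M.edgeSetoid K)
  finite_V := inferInstance
  finite_E := inferInstance
  src q := Quotient.mk _ (M.graph.src q.out)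
  tgt q := Quotient.mk _ (M.graph.tgt q.out)
  len q := Nat.card (M.edgeStabilizer K q.out) * M.graph.len q.out

/-- The class `[v]` of a vertex. -/
def vertexClass (v : M.graph.V) : (M.quotientGraph K).V := Quotient.mk (M.vertexSetoid K) v

/-- The class `[e]` of an edge. -/
def edgeClass (e : M.graph.E) : (M.quotientGraph K).E := Quotient.mk (M.edgeSetoid K) e

/-- The set of vertices of the model is stable under `K`, and the quotient graph has no loops (so
the model has none either). No element of `K` can then reverse an edge. -/
structure IsAdmissible : Prop where
  stable : ∀ σ ∈ K, ∀ v, ∃ w, σ (M.vertex v) = M.vertex w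
  loopless : ∀ e, M.vertexClass K (M.graph.src e) ≠ M.vertexClass K (M.graph.tgt e)

open Classical in
/-- `φ` is the map that sends every vertex `v` to `[v]` and every edge `e` to the edge `[e]`, linearly
with factor `|K_e|`. The two cases in `map_pt` are those where the quotient map respects or
reverses the reference orientations of `e` and `[e]`. -/
structure IsQuotientMap (φ : X → (M.quotientGraph K).Curve) : Prop where
  map_vertex : ∀ v, φ (M.vertex v) = (M.quotientGraph K).vertex (M.vertexClass K v)
  map_pt : ∀ e t, t ≤ M.graph.len e → φ (M.pt e t) =
    if M.vertexClass K (M.graph.src e) = (M.quotientGraph K).src (M.edgeClass K e) then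
      (M.quotientGraph K).pt (M.edgeClass K e) (Nat.card (M.edgeStabilizer K e) * t)
    else
      (M.quotientGraph K).pt (M.edgeClass K e)
        ((M.quotientGraph K).len (M.edgeClass K e) - Nat.card (M.edgeStabilizer K e) * t)

end Model

end Curves

/-! An element of `K` is only a homeomorphism preserving the path metric, so its action on the graph
has to be recovered first. If it permutes the vertices, it permutes the components of their
complement, which are the open edges, and it preserves `depth`, the distance to the vertex set. On
an edge of length `L` the depth at `t` is `min t (L - t)`, so lengths are preserved and each point
goes to position `t` or `L - t`. Connectedness of half an edge makes the choice uniform along the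
edge (`IsVertexIsometry.map_pt`).

An admissible model arises by adding the finite `K`-orbits of the vertices and then cutting every
finite edge at its midpoint: midpoints are permuted among themselves and are never in the orbit of
an old vertex. Infinite edges stay whole, because their end at infinity is metrically different from
their other end (`exists_isAdmissible`).

In an admissible model no element of `K` reverses an edge, since the ends have different classes.
Hence the position along `[e]` is `K`-invariant (`coord_map`), which identifies the fibres of the
quotient map with the orbits, and the quotient map is injective on each edge.

Harmonicity is then orbit counting. Fix a half-edge `h'` at `φ x` and an edge `e₀` at `x` above it.
The elements of `K` taking `e₀` to the edge `e` of a half-edge above `h'` form a torsor under `K_e`,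
and they all fix `x` by injectivity on `e`. Summing over the half-edges above `h'` gives the order
of the stabilizer `K_x`, whatever `h'` is (`localDegree_eq`). Summing these orders over an orbit
gives the order of `K`. -/

theorem segLength_comm (s t : ℝ≥0∞) : segLength s t = segLength t s := add_comm _ _

theorem segLength_of_le {s t : ℝ≥0∞} (h : s ≤ t) : segLength s t = t - s := by
  simp [segLength, tsub_eq_zero_of_le h]

theorem le_add_segLength (s t : ℝ≥0∞) : s ≤ t + segLength s t :=
  le_tsub_add.trans (by rw [add_comm]; gcongr; exact le_self_add)

/-! ### Points, maps and open sets of a glued curve -/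

namespace WeightedGraph

variable {G : WeightedGraph}

theorem pt_zero (e : G.E) : G.pt e 0 = G.vertex (G.src e) := by
  rw [vertex, ← Quot.sound (Glue.src e)]
  simp [pt]
  rfl

theorem pt_len (e : G.E) : G.pt e (G.len e) = G.vertex (G.tgt e) := by
  rw [vertex, ← Quot.sound (Glue.tgt e)]
  simp [pt]
  rfl

theorem mk_inr (e : G.E) (t : Set.Iic (G.len e)) :
    (Quot.mk _ (Sum.inr ⟨e, t⟩) : G.Curve) = G.pt e t := by
  have : min (t : ℝ≥0∞) (G.len e) = t := min_eq_left t.2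
  simp [pt, this]

theorem exists_pt_or_vertex (x : G.Curve) :
    (∃ v, x = G.vertex v) ∨ ∃ e t, 0 < t ∧ t < G.len e ∧ x = G.pt e t := by
  obtain ⟨p, rfl⟩ := Quot.exists_rep x
  rcases p with v | ⟨e, t⟩
  · exact .inl ⟨v, rfl⟩
  · rw [mk_inr]
    rcases eq_or_ne (t : ℝ≥0∞) 0 with h | h
    · exact .inl ⟨_, by rw [h, pt_zero]⟩
    · rcases eq_or_lt_of_le (Set.mem_Iic.1 t.2) with h' | h'
      · exact .inl ⟨_, by rw [h', pt_len]⟩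
      · exact .inr ⟨e, t, pos_iff_ne_zero.2 h, h', rfl⟩

/-- A map on the curve given by its values on the vertices and along the edges. -/
def lift {Y : Type*} (fV : G.V → Y) (fE : G.E → ℝ≥0∞ → Y)
    (h₀ : ∀ e, fE e 0 = fV (G.src e)) (h₁ : ∀ e, fE e (G.len e) = fV (G.tgt e)) : G.Curve → Y :=
  Quot.lift (Sum.elim fV fun p => fE p.1 p.2) (by rintro _ _ (e | e) <;> simp [h₀, h₁])

section lift

variable {Y : Type*} {fV : G.V → Y} {fE : G.E → ℝ≥0∞ → Y}
  {h₀ : ∀ e, fE e 0 = fV (G.src e)} {h₁ : ∀ e, fE e (G.len e) = fV (G.tgt e)}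

@[simp]
theorem lift_vertex (v : G.V) : lift fV fE h₀ h₁ (G.vertex v) = fV v := rfl

theorem lift_pt {e : G.E} {t : ℝ≥0∞} (ht : t ≤ G.len e) :
    lift fV fE h₀ h₁ (G.pt e t) = fE e t := by
  change fE e (min t (G.len e)) = _
  rw [min_eq_left ht]

theorem continuous_lift [TopologicalSpace Y] (h : ∀ e, ContinuousOn (fE e) (Iic (G.len e))) :
    Continuous (lift fV fE h₀ h₁) := by
  let : TopologicalSpace G.V := ⊥
  have : DiscreteTopology G.V := ⟨rfl⟩
  refine continuous_coinduced_dom.2 (continuous_sum_dom.2 ⟨continuous_of_discreteTopology, ?_⟩)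
  refine continuous_sigma fun e => ?_
  exact (h e).domRestrict

end lift

theorem continuous_pt (e : G.E) : Continuous (G.pt e) := by
  let : TopologicalSpace G.V := ⊥
  have h : Continuous (Quot.mk G.Glue : G.PrePoint → G.Curve) := continuous_coinduced_rng
  refine h.comp (continuous_inr.comp (continuous_sigmaMk.comp ?_))
  fun_prop

/-- For the coinduced topology openness is tested on each interval; the discrete vertex set imposes
no condition. -/
theorem isOpen_of_pt {W : Set G.Curve}
    (h : ∀ e, ∃ U : Set ℝ≥0∞, IsOpen U ∧ ∀ t ≤ G.len e, G.pt e t ∈ W ↔ t ∈ U) : IsOpen W := by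
  let : TopologicalSpace G.V := ⊥
  have : DiscreteTopology G.V := ⟨rfl⟩
  refine isOpen_coinduced.2 (isOpen_sum_iff.2 ⟨isOpen_discrete _, isOpen_sigma_iff.2 fun e => ?_⟩)
  obtain ⟨U, hU, hW⟩ := h e
  convert hU.preimage continuous_subtype_val using 1
  ext t
  have := hW t t.2
  rw [← mk_inr] at this
  exact this

section normalForm

open Classical in
/-- Vertices, and interior points of the edges, as a disjoint union. -/
noncomputable def normalForm (hpos : ∀ e, 0 < G.len e) : G.Curve → G.V ⊕ G.E × ℝ≥0∞ :=
  lift Sum.inl (fun e t => if t = 0 then Sum.inl (G.src e) else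
    if t = G.len e then Sum.inl (G.tgt e) else Sum.inr (e, t)) (by simp)
    (fun e => by simp [(hpos e).ne'])

/-- Gluing only produces equalities of points. To prove points distinct, one needs a function that
respects the gluing and separates them, and this is the role of `normalForm`. -/
theorem normalForm_pt (hpos : ∀ e, 0 < G.len e) {e : G.E} {t : ℝ≥0∞} (h₀ : 0 < t)
    (h₁ : t < G.len e) : normalForm hpos (G.pt e t) = Sum.inr (e, t) := by
  rw [normalForm, lift_pt h₁.le]
  simp [h₀.ne', h₁.ne]

theorem vertex_injective (hpos : ∀ e, 0 < G.len e) : Function.Injective G.vertex :=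
  fun _ _ h => Sum.inl_injective (congrArg (normalForm hpos) h)

theorem pt_ne_vertex (hpos : ∀ e, 0 < G.len e) {e : G.E} {t : ℝ≥0∞} (h₀ : 0 < t)
    (h₁ : t < G.len e) (v : G.V) : G.pt e t ≠ G.vertex v := by
  intro h
  have := congrArg (normalForm hpos) h
  rw [normalForm_pt hpos h₀ h₁] at this
  simp [normalForm] at this

theorem pt_eq_pt_of_pos_of_lt (hpos : ∀ e, 0 < G.len e) {e f : G.E} {s t : ℝ≥0∞} (hs : s ≤ G.len e)
    (h₀ : 0 < t) (h₁ : t < G.len f) (h : G.pt e s = G.pt f t) : e = f ∧ s = t := by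
  have hn := normalForm_pt hpos h₀ h₁
  rcases eq_or_ne s 0 with rfl | hs0
  · rw [pt_zero] at h
    exact absurd h.symm (pt_ne_vertex hpos h₀ h₁ _)
  rcases eq_or_lt_of_le hs with rfl | hs1
  · rw [pt_len] at h
    exact absurd h.symm (pt_ne_vertex hpos h₀ h₁ _)
  rw [← h, normalForm_pt hpos (pos_iff_ne_zero.2 hs0) hs1] at hn
  simpa using hn

theorem pt_injOn (hpos : ∀ e, 0 < G.len e) {e : G.E} (he : G.src e ≠ G.tgt e) :
    InjOn (G.pt e) (Iic (G.len e)) := by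
  intro s hs t ht h
  rcases eq_or_ne t 0 with rfl | ht0
  · rcases eq_or_ne s 0 with rfl | hs0
    · rfl
    rcases eq_or_lt_of_le (mem_Iic.1 hs) with rfl | hs1
    · rw [pt_len, pt_zero] at h
      exact absurd (vertex_injective hpos h).symm he
    · exact ((pt_eq_pt_of_pos_of_lt hpos ht (pos_iff_ne_zero.2 hs0) hs1 h.symm).2).symm
  rcases eq_or_lt_of_le (mem_Iic.1 ht) with rfl | ht1
  · rcases eq_or_ne s 0 with rfl | hs0
    · rw [pt_len, pt_zero] at h
      exact absurd (vertex_injective hpos h) he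
    rcases eq_or_lt_of_le (mem_Iic.1 hs) with rfl | hs1
    · rfl
    · exact ((pt_eq_pt_of_pos_of_lt hpos ht (pos_iff_ne_zero.2 hs0) hs1 h.symm).2).symm
  · exact (pt_eq_pt_of_pos_of_lt hpos hs (pos_iff_ne_zero.2 ht0) ht1 h).2

theorem pt_mem_image_iff (hpos : ∀ e, 0 < G.len e) {e f : G.E} {t : ℝ≥0∞} (ht : t ≤ G.len e)
    {U : Set ℝ≥0∞} (hU : U ⊆ Ioo 0 (G.len f)) : G.pt e t ∈ G.pt f '' U ↔ e = f ∧ t ∈ U := by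
  constructor
  · rintro ⟨s, hs, h⟩
    obtain ⟨rfl, rfl⟩ := pt_eq_pt_of_pos_of_lt hpos ht (hU hs).1 (hU hs).2 h.symm
    exact ⟨rfl, hs⟩
  · rintro ⟨rfl, hs⟩
    exact mem_image_of_mem _ hs

theorem isOpen_pt_image (hpos : ∀ e, 0 < G.len e) {f : G.E} {U : Set ℝ≥0∞} (hU : IsOpen U)
    (hU' : U ⊆ Ioo 0 (G.len f)) : IsOpen (G.pt f '' U) := by
  refine isOpen_of_pt fun e => ?_
  by_cases h : e = f
  · exact ⟨U, hU, fun t ht => by rw [pt_mem_image_iff hpos ht hU']; simp [h]⟩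
  · exact ⟨∅, isOpen_empty, fun t ht => by rw [pt_mem_image_iff hpos ht hU']; simp [h]⟩

end normalForm

/-! ### Neighbourhoods of vertices -/

section star

/-- The vertex `w` with the initial parts, up to the points `c e`, of the edges leaving it. -/
def star (c : G.E → ℝ≥0∞) (h₀ : ∀ e, 0 < c e) (h₁ : ∀ e, c e < G.len e) (w : G.V) : Set G.Curve :=
  {x | lift (Y := Prop) (fun v => v = w)
    (fun e t => (G.src e = w ∧ t < c e) ∨ (G.tgt e = w ∧ c e < t))
    (fun e => by simp [h₀]) (fun e => by simp [h₁, (h₁ e).le]) x}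

variable {c : G.E → ℝ≥0∞} {h₀ : ∀ e, 0 < c e} {h₁ : ∀ e, c e < G.len e}

theorem pt_mem_star {w : G.V} {e : G.E} {t : ℝ≥0∞} (ht : t ≤ G.len e) :
    G.pt e t ∈ star c h₀ h₁ w ↔ (G.src e = w ∧ t < c e) ∨ (G.tgt e = w ∧ c e < t) := by
  simp only [star, mem_ofPred_eq, lift_pt ht]

theorem vertex_mem_star {v w : G.V} : G.vertex v ∈ star c h₀ h₁ w ↔ v = w := Iff.rfl

theorem isOpen_star (w : G.V) : IsOpen (star c h₀ h₁ w) := by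
  refine isOpen_of_pt fun e => ⟨{t | (G.src e = w ∧ t < c e) ∨ (G.tgt e = w ∧ c e < t)}, ?_,
    fun t ht => pt_mem_star ht⟩
  exact (isOpen_const.and isOpen_Iio).union (isOpen_const.and isOpen_Ioi)

/-- Stars of different vertices with the same cut points `c` are disjoint. This much of the
Hausdorff property is enough to identify the images of the ends of an edge, including those at
infinity, where the metric gives no control. -/
theorem eq_of_tendsto_vertex (hpos : ∀ e, 0 < G.len e) {α : Type*} {l : Filter α} [l.NeBot]
    {γ : α → G.Curve} {v w : G.V} (hv : Tendsto γ l (𝓝 (G.vertex v)))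
    (hw : Tendsto γ l (𝓝 (G.vertex w))) : v = w := by
  choose c h₀ h₁ using fun e => exists_between (hpos e)
  have hv' : ∀ᶠ a in l, γ a ∈ star c h₀ h₁ v :=
    hv.eventually ((isOpen_star (h₀ := h₀) (h₁ := h₁) v).mem_nhds (vertex_mem_star.2 rfl))
  have hw' : ∀ᶠ a in l, γ a ∈ star c h₀ h₁ w :=
    hw.eventually ((isOpen_star (h₀ := h₀) (h₁ := h₁) w).mem_nhds (vertex_mem_star.2 rfl))
  obtain ⟨a, ha, hb⟩ := (hv'.and hw').exists
  rcases exists_pt_or_vertex (γ a) with ⟨u, hu⟩ | ⟨e, t, h0, h1, hu⟩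
  · rw [hu, vertex_mem_star] at ha hb
    exact ha.symm.trans hb
  · rw [hu, pt_mem_star h1.le] at ha hb
    rcases ha with ha | ha <;> rcases hb with hb | hb
    · exact ha.1.symm.trans hb.1
    · exact absurd ha.2 hb.2.not_gt
    · exact absurd ha.2 hb.2.not_gt
    · exact ha.1.symm.trans hb.1

end star

/-! ### The path metric and the distance to the vertices -/

section edist

theorem edist_self (x : G.Curve) : edist x x = 0 :=
  le_antisymm (sInf_le (ChainLength.refl x)) bot_le

theorem ChainLength.trans {x y z : G.Curve} {r r' : ℝ≥0∞} (h : G.ChainLength x y r)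
    (h' : G.ChainLength y z r') : G.ChainLength x z (r + r') := by
  induction h with
  | refl => simpa using h'
  | step e s t y r hs ht _ ih => rw [add_assoc]; exact .step e s t _ _ hs ht (ih h')

theorem edist_triangle (x y z : G.Curve) : edist x z ≤ edist x y + edist y z := by
  change _ ≤ sInf _ + sInf _
  rw [ENNReal.sInf_add]
  refine le_iInf₂ fun r hr => ?_
  rw [add_comm, ENNReal.sInf_add]
  refine le_iInf₂ fun r' hr' => ?_
  rw [add_comm]
  exact sInf_le (hr.trans hr')

theorem edist_pt_le {e : G.E} {s t : ℝ≥0∞} (hs : s ≤ G.len e) (ht : t ≤ G.len e) :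
    edist (G.pt e s) (G.pt e t) ≤ segLength s t := by
  refine sInf_le ?_
  simpa using ChainLength.step e s t _ 0 hs ht (.refl _)

/-- By induction on a chain, a function that is 1-Lipschitz along each edge is 1-Lipschitz for the
path metric. Lower bounds for distances come from a suitable choice of `χ`. -/
theorem le_add_edist {χ : G.Curve → ℝ≥0∞}
    (h : ∀ e s t, s ≤ G.len e → t ≤ G.len e → χ (G.pt e s) ≤ χ (G.pt e t) + segLength s t)
    (x y : G.Curve) : χ x ≤ χ y + edist x y := by
  rw [← tsub_le_iff_left]
  refine le_sInf fun r hr => ?_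
  rw [tsub_le_iff_left]
  induction hr with
  | refl => simp
  | step e s t y r hs ht _ ih =>
    refine (h e s t hs ht).trans ?_
    rw [add_comm (segLength s t), ← add_assoc]
    gcongr

theorem edist_map_le {H : WeightedGraph} {φ : G.Curve → H.Curve}
    (h : ∀ e s t, s ≤ G.len e → t ≤ G.len e →
      edist (φ (G.pt e s)) (φ (G.pt e t)) ≤ segLength s t) (x y : G.Curve) :
    edist (φ x) (φ y) ≤ edist x y := by
  have := le_add_edist (χ := fun z => edist (φ z) (φ y)) (fun e s t hs ht => ?_) x y
  · simpa [edist_self] using this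
  · refine (edist_triangle _ (φ (G.pt e t)) _).trans ?_
    rw [add_comm]
    gcongr
    exact h e s t hs ht

theorem min_sub_le_add_segLength {L s t : ℝ≥0∞} (ht : t ≤ L) :
    min s (L - s) ≤ min t (L - t) + segLength s t := by
  rw [min_add]
  refine le_min ((min_le_left _ _).trans (le_add_segLength s t)) ((min_le_right _ _).trans ?_)
  rw [tsub_le_iff_right, add_assoc]
  have := le_add_segLength t s
  rw [add_comm, segLength_comm] at this
  calc L = L - t + t := (tsub_add_cancel_of_le ht).symm
    _ ≤ _ := by gcongr

/-- The distance to the set of vertices. -/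
noncomputable def depth : G.Curve → ℝ≥0∞ :=
  lift (fun _ => 0) (fun e t => min t (G.len e - t)) (by simp) (by simp)

theorem depth_pt {e : G.E} {t : ℝ≥0∞} (ht : t ≤ G.len e) :
    depth (G.pt e t) = min t (G.len e - t) := lift_pt ht

/-- With `exists_edist_vertex_le_depth`, this shows that `depth`, defined by a formula on each edge,
is metric in nature and so is preserved by isometries permuting the vertices. -/
theorem depth_le_edist_vertex (x : G.Curve) (v : G.V) : depth x ≤ edist x (G.vertex v) := by
  have := le_add_edist (χ := depth (G := G)) (fun e s t hs ht => ?_) x (G.vertex v)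
  · simpa [depth] using this
  · rw [depth_pt hs, depth_pt ht]
    exact min_sub_le_add_segLength ht

theorem exists_edist_vertex_le_depth (x : G.Curve) : ∃ v, edist x (G.vertex v) ≤ depth x := by
  rcases exists_pt_or_vertex x with ⟨v, rfl⟩ | ⟨e, t, -, h1, rfl⟩
  · exact ⟨v, by simp [edist_self]⟩
  · rw [depth_pt h1.le]
    rcases min_choice t (G.len e - t) with h | h <;> rw [h]
    · refine ⟨G.src e, ?_⟩
      rw [← pt_zero]
      refine (edist_pt_le h1.le zero_le).trans ?_
      rw [segLength_comm, segLength_of_le zero_le, tsub_zero]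
    · refine ⟨G.tgt e, ?_⟩
      rw [← pt_len]
      refine (edist_pt_le h1.le le_rfl).trans ?_
      rw [segLength_of_le h1.le]

theorem depth_map_le {σ : G.Curve → G.Curve} (hσ : ∀ x y, edist (σ x) (σ y) = edist x y)
    (hv : ∀ v, ∃ w, σ (G.vertex v) = G.vertex w) (x : G.Curve) : depth (σ x) ≤ depth x := by
  obtain ⟨v, h⟩ := exists_edist_vertex_le_depth x
  obtain ⟨w, hw⟩ := hv v
  calc depth (σ x) ≤ edist (σ x) (G.vertex w) := depth_le_edist_vertex _ _
    _ = edist x (G.vertex v) := by rw [← hw, hσ]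
    _ ≤ _ := h

/-- The function that is `0` at the end at infinity and `∞` elsewhere satisfies the condition of
`le_add_edist`: the leaf condition lets only `e` reach this end, only at the parameter `∞`, and
there every nontrivial segment has infinite length. -/
theorem edist_pt_top (hG : G.IsTropical) {e : G.E} (he : G.len e = ∞) {y : G.Curve}
    (hy : y ≠ G.vertex (G.tgt e)) : edist y (G.vertex (G.tgt e)) = ∞ := by
  classical
  have := le_add_edist (χ := fun z => if z = G.vertex (G.tgt e) then 0 else ∞)
    (fun f s t hs ht => ?_) y (G.vertex (G.tgt e))
  · simpa [hy] using this
  · have key : ∀ u ≤ G.len f, G.pt f u = G.vertex (G.tgt e) → f = e ∧ u = ∞ := by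
      intro u hu h
      rcases eq_or_ne u 0 with rfl | hu0
      · rw [pt_zero] at h
        have h := vertex_injective hG.len_pos h
        obtain rfl := hG.leaf_of_top e he f (.inl h)
        exact absurd h (hG.not_loop_of_top f he)
      · rcases eq_or_lt_of_le hu with rfl | hu1
        · rw [pt_len] at h
          have h := vertex_injective hG.len_pos h
          obtain rfl := hG.leaf_of_top e he f (.inr h)
          exact ⟨rfl, he⟩
        · exact absurd h (pt_ne_vertex hG.len_pos (pos_iff_ne_zero.2 hu0) hu1 _)
    split_ifs with h₁ h₂ h₂
    · exact bot_le
    · exact bot_le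
    · obtain ⟨rfl, rfl⟩ := key t ht h₂
      have : s ≠ ∞ := fun h => h₁ (h ▸ h₂)
      simp [segLength, this]
    · simp

end edist

end WeightedGraph

/-! ### Isometries that permute the vertices act on the edges -/

theorem ENNReal.eq_or_eq_sub_of_min_eq {L a b : ℝ≥0∞} (hL : L ≠ ∞) (ha : a ≤ L) (hb : b ≤ L)
    (h : min a (L - a) = min b (L - b)) : a = b ∨ a = L - b := by
  have key : ∀ {x y}, x ≤ L → y = L - x → x = L - y := by
    rintro x y hx rfl
    rw [ENNReal.sub_sub_cancel hL hx]
  rcases min_choice a (L - a) with h1 | h1 <;> rcases min_choice b (L - b) with h2 | h2 <;>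
    rw [h1, h2] at h
  · exact .inl h
  · exact .inr h
  · exact .inr (key ha h.symm)
  · refine .inl ?_
    rw [← ENNReal.sub_sub_cancel hL ha, h, ENNReal.sub_sub_cancel hL hb]

namespace WeightedGraph

variable {G : WeightedGraph}

/-- The complement of the vertices is the disjoint union of the open edges, so a connected set
avoiding the vertices lies in a single one. -/
theorem edge_image_subset (hpos : ∀ e, 0 < G.len e) {S : Set G.Curve} (hS : IsPreconnected S)
    (hS' : ∀ x ∈ S, ∀ v, x ≠ G.vertex v) {f : G.E} (hf : (S ∩ G.pt f '' Ioo 0 (G.len f)).Nonempty) :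
    S ⊆ G.pt f '' Ioo 0 (G.len f) := by
  refine hS.subset_left_of_subset_union (v := ⋃ (e) (_ : e ≠ f), G.pt e '' Ioo 0 (G.len e))
    (isOpen_pt_image hpos isOpen_Ioo Subset.rfl)
    (isOpen_biUnion fun e _ => isOpen_pt_image hpos isOpen_Ioo Subset.rfl) ?_ ?_ hf
  · rw [Set.disjoint_left]
    rintro _ ⟨s, hs, rfl⟩ h
    obtain ⟨e, he, h⟩ := mem_iUnion₂.1 h
    exact he ((pt_mem_image_iff hpos hs.2.le Subset.rfl).1 h).1.symm
  · intro x hx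
    rcases exists_pt_or_vertex x with ⟨v, rfl⟩ | ⟨e, t, h0, h1, rfl⟩
    · exact absurd rfl (hS' _ hx v)
    · by_cases h : e = f
      · subst h
        exact .inl ⟨t, ⟨h0, h1⟩, rfl⟩
      · exact .inr (mem_iUnion₂.2 ⟨e, h, t, ⟨h0, h1⟩, rfl⟩)

variable {σ : G.Curve ≃ₜ G.Curve}

/-- `σ` is an isometry that permutes the vertices. -/
structure IsVertexIsometry (σ : G.Curve ≃ₜ G.Curve) : Prop where
  edist_eq : ∀ x y, edist (σ x) (σ y) = edist x y
  map_vertex : ∀ v, ∃ w, σ (G.vertex v) = G.vertex w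
  symm_map_vertex : ∀ v, ∃ w, σ.symm (G.vertex v) = G.vertex w

namespace IsVertexIsometry

theorem symm (h : IsVertexIsometry σ) : IsVertexIsometry σ.symm where
  edist_eq x y := by rw [← h.edist_eq]; simp
  map_vertex := h.symm_map_vertex
  symm_map_vertex := h.map_vertex

theorem depth_eq (h : IsVertexIsometry σ) (x : G.Curve) : depth (σ x) = depth x := by
  refine le_antisymm (depth_map_le h.edist_eq h.map_vertex x) ?_
  conv_lhs => rw [← σ.symm_apply_apply x]
  exact depth_map_le h.symm.edist_eq h.symm.map_vertex (σ x)

theorem ne_vertex (h : IsVertexIsometry σ) (hpos : ∀ e, 0 < G.len e) {e : G.E} {t : ℝ≥0∞}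
    (ht : t ∈ Ioo 0 (G.len e)) (v : G.V) : σ (G.pt e t) ≠ G.vertex v := by
  intro h'
  obtain ⟨w, hw⟩ := h.symm_map_vertex v
  rw [← h', σ.symm_apply_apply] at hw
  exact pt_ne_vertex hpos ht.1 ht.2 _ hw

theorem exists_edge (h : IsVertexIsometry σ) (hpos : ∀ e, 0 < G.len e) (e : G.E) :
    ∃ f, σ '' (G.pt e '' Ioo 0 (G.len e)) ⊆ G.pt f '' Ioo 0 (G.len f) := by
  obtain ⟨t, ht⟩ := exists_between (hpos e)
  rcases exists_pt_or_vertex (σ (G.pt e t)) with ⟨v, hv⟩ | ⟨f, s, h0, h1, hs⟩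
  · exact absurd hv (h.ne_vertex hpos ht v)
  · refine ⟨f, edge_image_subset hpos ?_ ?_ ⟨_, ⟨_, ⟨t, ht, rfl⟩, rfl⟩, s, ⟨h0, h1⟩, hs.symm⟩⟩
    · exact (isPreconnected_Ioo.image _ (continuous_pt e).continuousOn).image _
        σ.continuous.continuousOn
    · rintro _ ⟨_, ⟨s, hs, rfl⟩, rfl⟩ v
      exact h.ne_vertex hpos hs v

/-- The depth is invariant under `σ`; it is at most `G.len f / 2` on `f`, but takes every positive
value below `G.len e / 2` on `e`. The argument also covers infinite lengths. -/
theorem len_le (h : IsVertexIsometry σ) {e f : G.E}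
    (hf : σ '' (G.pt e '' Ioo 0 (G.len e)) ⊆ G.pt f '' Ioo 0 (G.len f)) :
    G.len e ≤ G.len f := by
  have key : ∀ t ∈ Ioo 0 (G.len e), min t (G.len e - t) ≤ G.len f / 2 := by
    intro t ht
    obtain ⟨s, hs, hst⟩ := hf ⟨_, ⟨t, ht, rfl⟩, rfl⟩
    rw [← depth_pt ht.2.le, ← h.depth_eq, ← hst, depth_pt hs.2.le]
    by_contra! hlt
    have := ENNReal.add_lt_add (lt_min_iff.1 hlt).1 (lt_min_iff.1 hlt).2
    rw [ENNReal.add_halves, add_tsub_cancel_of_le hs.2.le] at this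
    exact this.false
  by_contra! hlt
  obtain ⟨t, ht⟩ := exists_between (ENNReal.div_lt_div_right two_ne_zero ENNReal.ofNat_ne_top hlt)
  have hle : t ≤ G.len e / 2 := ht.2.le
  have hlt' : t < G.len e := ht.2.trans_le ENNReal.half_le_self
  refine ((key t ⟨bot_le.trans_lt ht.1, hlt'⟩).trans_lt ht.1).not_ge (le_min le_rfl ?_)
  refine ENNReal.le_sub_of_add_le_right hlt'.ne_top ?_
  exact (add_le_add hle hle).trans_eq (ENNReal.add_halves _)

theorem exists_edge_image (h : IsVertexIsometry σ) (hpos : ∀ e, 0 < G.len e) (e : G.E) :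
    ∃ f, G.len f = G.len e ∧ ∀ t ∈ Ioo 0 (G.len e), ∃ s ∈ Ioo 0 (G.len e),
      σ (G.pt e t) = G.pt f s := by
  obtain ⟨f, hf⟩ := h.exists_edge hpos e
  obtain ⟨e', he'⟩ := h.symm.exists_edge hpos f
  have hee' : e = e' := by
    obtain ⟨t, ht⟩ := exists_between (hpos e)
    obtain ⟨s, hs, hst⟩ := hf ⟨_, ⟨t, ht, rfl⟩, rfl⟩
    have := he' ⟨_, ⟨s, hs, rfl⟩, rfl⟩
    rw [hst, σ.symm_apply_apply] at this
    exact ((pt_mem_image_iff hpos ht.2.le Subset.rfl).1 this).1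
  subst hee'
  have hlen : G.len f = G.len e := le_antisymm (h.symm.len_le he') (h.len_le hf)
  refine ⟨f, hlen, fun t ht => ?_⟩
  obtain ⟨s, hs, hst⟩ := hf ⟨_, ⟨t, ht, rfl⟩, rfl⟩
  exact ⟨s, hlen ▸ hs, hst.symm⟩

/-- At an end of the edge both sides are vertices and are limits of the same interior points, so
`eq_of_tendsto_vertex` applies. Continuity of `σ` is what settles the ends at infinity. -/
theorem eqOn_closed (h : IsVertexIsometry σ) (hpos : ∀ e, 0 < G.len e) {e f : G.E}
    {u : ℝ≥0∞ → ℝ≥0∞} (hu : Continuous u) (hσ : ∀ t ∈ Ioo 0 (G.len e), σ (G.pt e t) = G.pt f (u t))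
    (h₀ : ∃ v, G.pt f (u 0) = G.vertex v) (h₁ : ∃ v, G.pt f (u (G.len e)) = G.vertex v) :
    ∀ t ≤ G.len e, σ (G.pt e t) = G.pt f (u t) := by
  have key : ∀ (t₀ : ℝ≥0∞) (l : Filter ℝ≥0∞) [l.NeBot], l ≤ 𝓝 t₀ → Ioo 0 (G.len e) ∈ l →
      (∃ v, G.pt e t₀ = G.vertex v) → (∃ v, G.pt f (u t₀) = G.vertex v) →
      σ (G.pt e t₀) = G.pt f (u t₀) := by
    rintro t₀ l _ hl hmem ⟨v, hv⟩ ⟨w, hw⟩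
    obtain ⟨v', hv'⟩ := h.map_vertex v
    have h1 : Tendsto (fun t => σ (G.pt e t)) l (𝓝 (G.vertex v')) := by
      rw [← hv', ← hv]
      exact ((σ.continuous.comp (continuous_pt e)).tendsto t₀).mono_left hl
    have h2 : Tendsto (fun t => σ (G.pt e t)) l (𝓝 (G.vertex w)) := by
      rw [← hw]
      refine ((((continuous_pt f).comp hu).tendsto t₀).mono_left hl).congr' ?_
      filter_upwards [hmem] with t ht using (hσ t ht).symm
    rw [hv, hv', hw, eq_of_tendsto_vertex hpos h1 h2]
  intro t ht
  rcases eq_or_ne t 0 with rfl | h0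
  · have : (𝓝[>] (0 : ℝ≥0∞)).NeBot := nhdsGT_neBot_of_exists_gt ⟨_, hpos e⟩
    exact key 0 (𝓝[>] 0) inf_le_left (Ioo_mem_nhdsGT (hpos e)) ⟨_, pt_zero e⟩ h₀
  rcases eq_or_lt_of_le ht with rfl | h1
  · have : (𝓝[<] (G.len e)).NeBot := nhdsLT_neBot_of_exists_lt ⟨_, hpos e⟩
    exact key _ (𝓝[<] _) inf_le_left (Ioo_mem_nhdsLT (hpos e)) ⟨_, pt_len e⟩ h₁
  · exact hσ t ⟨pos_iff_ne_zero.2 h0, h1⟩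

/-- An isometry permuting the vertices maps each edge onto an edge of the same length, preserving or
reversing the orientation. -/
theorem map_pt (h : IsVertexIsometry σ) (hpos : ∀ e, 0 < G.len e) (e : G.E) :
    ∃ f, G.len f = G.len e ∧ ((∀ t ≤ G.len e, σ (G.pt e t) = G.pt f t) ∨
      (G.len e ≠ ∞ ∧ ∀ t ≤ G.len e, σ (G.pt e t) = G.pt f (G.len e - t))) := by
  obtain ⟨f, hf, hg⟩ := h.exists_edge_image hpos e
  refine ⟨f, hf, ?_⟩
  choose! g hgI hg using hg
  have hmin : ∀ t ∈ Ioo 0 (G.len e), min (g t) (G.len e - g t) = min t (G.len e - t) := by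
    intro t ht
    have := h.depth_eq (G.pt e t)
    rwa [hg t ht, depth_pt ht.2.le, depth_pt (hf ▸ (hgI t ht).2.le), hf] at this
  suffices (∀ t ∈ Ioo 0 (G.len e), g t = t) ∨
      (G.len e ≠ ∞ ∧ ∀ t ∈ Ioo 0 (G.len e), g t = G.len e - t) by
    rcases this with h1 | ⟨h1, h2⟩
    · refine .inl (h.eqOn_closed hpos (u := fun t => t) continuous_id' (fun t ht => ?_) ⟨_, pt_zero f⟩ ⟨G.tgt f, ?_⟩)
      · rw [hg t ht, h1 t ht]
      · rw [← hf, pt_len]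
    · refine .inr ⟨h1, h.eqOn_closed hpos (ENNReal.continuous_sub_left h1) (fun t ht => ?_)
        ⟨G.tgt f, ?_⟩ ⟨G.src f, ?_⟩⟩
      · rw [hg t ht, h2 t ht]
      · rw [tsub_zero, ← hf, pt_len]
      · rw [tsub_self, pt_zero]
  -- On an infinite edge the depth of a finite point is its parameter, so `g` is the identity there.
  rcases eq_or_ne (G.len e) ∞ with hL | hL
  · refine .inl fun t ht => ?_
    have := hmin t ht
    rwa [hL, ENNReal.top_sub (hL ▸ (hgI t ht).2.ne), ENNReal.top_sub (hL ▸ ht.2.ne), min_eq_left le_top,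
      min_eq_left le_top] at this
  set L := G.len e with hLdef
  have hcase : ∀ t ∈ Ioo 0 L, g t = t ∨ g t = L - t := fun t ht =>
    ENNReal.eq_or_eq_sub_of_min_eq hL (hgI t ht).2.le ht.2.le (hmin t ht)
  have hhalf : L / 2 < L := ENNReal.half_lt_self (hpos e).ne' hL
  have hsubhalf : L - L / 2 = L / 2 := ENNReal.sub_half hL
  have hlt : ∀ t < L / 2, L / 2 < L - t := fun t ht => by
    rw [lt_tsub_iff_right]
    conv_rhs => rw [← ENNReal.add_halves L]
    exact ENNReal.add_lt_add_left (hhalf.trans_le le_top).ne ht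
  have hmem : ∀ t ∈ Ioo 0 (L / 2), t ∈ Ioo 0 L := fun t ht => ⟨ht.1, ht.2.trans hhalf⟩
  have hinj : ∀ s ∈ Ioo 0 L, ∀ t ∈ Ioo 0 L, g s = g t → s = t := fun s hs t ht hst =>
    (pt_eq_pt_of_pos_of_lt hpos hs.2.le ht.1 ht.2
      (σ.injective (by rw [hg s hs, hg t ht, hst]))).2
  have hrefl : ∀ t ∈ Ioo 0 L, t ∈ Ioo 0 (L / 2) ∨ t = L - t ∨
      (L - t ∈ Ioo 0 (L / 2) ∧ L - (L - t) = t) := by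
    intro t ht
    rcases lt_trichotomy t (L / 2) with h' | rfl | h'
    · exact .inl ⟨ht.1, h'⟩
    · exact .inr (.inl hsubhalf.symm)
    · refine .inr (.inr ⟨⟨tsub_pos_of_lt ht.2, ?_⟩, ENNReal.sub_sub_cancel hL ht.2.le⟩)
      refine ENNReal.sub_lt_of_lt_add ht.2.le ?_
      conv_lhs => rw [← ENNReal.add_halves L]
      exact ENNReal.add_lt_add_left (hhalf.trans_le le_top).ne h'
  -- The value `L / 2` is excluded, since only the midpoint has depth `L / 2`. Hence `g` keeps the
  -- connected first half of the edge on one side of the midpoint. Continuity of `g` is used only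
  -- through preimages of open subsets of `f` under `σ`.
  have hsplit : Ioo 0 (L / 2) ⊆ {t | g t < L / 2} ∨ Ioo 0 (L / 2) ⊆ {t | L / 2 < g t} := by
    have hO : ∀ U : Set ℝ≥0∞, IsOpen U → U ⊆ Ioo 0 L →
        IsOpen ((fun t => σ (G.pt e t)) ⁻¹' (G.pt f '' U)) := fun U hU hU' =>
      (isOpen_pt_image hpos hU (hf.symm ▸ hU')).preimage (σ.continuous.comp (continuous_pt e))
    have hO' : ∀ t ∈ Ioo 0 L, ∀ U ⊆ Ioo 0 L, σ (G.pt e t) ∈ G.pt f '' U ↔ g t ∈ U :=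
      fun t ht U hU => by
        rw [hg t ht, pt_mem_image_iff hpos (hf ▸ (hgI t ht).2.le) (hf.symm ▸ hU)]
        simp
    have hs1 : Ioo 0 (L / 2) ⊆ Ioo 0 L := hmem
    have hs2 : Ioo (L / 2) L ⊆ Ioo 0 L := Ioo_subset_Ioo_left bot_le
    refine ((isPreconnected_Ioo (a := 0) (b := L / 2)).subset_or_subset (hO (Ioo 0 (L / 2)) isOpen_Ioo hs1)
      (hO (Ioo (L / 2) L) isOpen_Ioo hs2) ?_ ?_).imp ?_ ?_
    · rw [Set.disjoint_left]
      rintro t ⟨s, hs, hst⟩ ⟨s', hs', hst'⟩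
      obtain ⟨-, rfl⟩ := pt_eq_pt_of_pos_of_lt hpos (hf.symm ▸ (hs1 hs).2.le) (hs2 hs').1
        (hf.symm ▸ hs'.2) (hst.trans hst'.symm)
      exact hs.2.not_gt hs'.1
    · intro t ht
      have hgI' := hgI t (hmem t ht)
      rcases lt_trichotomy (g t) (L / 2) with h' | h' | h'
      · exact .inl ((hO' t (hmem t ht) _ hs1).2 ⟨hgI'.1, h'⟩)
      · have := hmin t (hmem t ht)
        rw [h', hsubhalf, min_self, min_eq_left (ht.2.trans (hlt t ht.2)).le] at this
        exact absurd this ht.2.ne'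
      · exact .inr ((hO' t (hmem t ht) _ hs2).2 ⟨h', hgI'.2⟩)
    · exact fun H t ht => ((hO' t (hmem t ht) _ hs1).1 (H ht)).2
    · exact fun H t ht => ((hO' t (hmem t ht) _ hs2).1 (H ht)).1
  rcases hsplit with hs | hs
  · have h1 : ∀ t ∈ Ioo 0 (L / 2), g t = t := fun t ht =>
      (hcase t (hmem t ht)).resolve_right fun h' => (hlt t ht.2).not_gt (h' ▸ hs ht)
    refine .inl fun t ht => ?_
    rcases hrefl t ht with h' | h' | ⟨h', h''⟩
    · exact h1 t h'
    · rcases hcase t ht with H | H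
      · exact H
      · exact H.trans h'.symm
    -- Beyond the midpoint the wrong alternative `g t = L - t` is already the value of `g` at `L -
    -- t`, so injectivity excludes it.
    · rcases hcase t ht with H | H
      · exact H
      · rw [H]
        exact (hinj t ht _ (hmem _ h') (H.trans (h1 _ h').symm)).symm
  · have h1 : ∀ t ∈ Ioo 0 (L / 2), g t = L - t := fun t ht =>
      (hcase t (hmem t ht)).resolve_left fun h' => ht.2.not_gt (h' ▸ hs ht)
    refine .inr ⟨hL, fun t ht => ?_⟩
    rcases hrefl t ht with h' | h' | ⟨h', h''⟩
    · exact h1 t h'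
    · rcases hcase t ht with H | H
      · exact H.trans h'
      · exact H
    · rcases hcase t ht with H | H
      · rw [H]
        exact hinj t ht _ (hmem _ h') (H.trans ((h1 _ h').trans h'').symm)
      · exact H

end IsVertexIsometry

end WeightedGraph

/-! ### Subdividing edges does not change the curve -/

theorem segLength_add_left {c s t : ℝ≥0∞} (hc : c ≠ ∞) :
    segLength (c + s) (c + t) = segLength s t := by
  simp only [segLength, ENNReal.add_sub_add_eq_sub_left hc]

theorem segLength_sub_right {c s t : ℝ≥0∞} (hc : c ≠ ∞) (hs : c ≤ s) (ht : c ≤ t) :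
    segLength (s - c) (t - c) = segLength s t := by
  rw [← segLength_add_left hc, add_tsub_cancel_of_le hs, add_tsub_cancel_of_le ht]

theorem segLength_add_of_le {s c t : ℝ≥0∞} (h : s ≤ c) (h' : c ≤ t) :
    segLength s c + segLength c t = segLength s t := by
  rw [segLength_of_le h, segLength_of_le h', segLength_of_le (h.trans h'), add_comm,
    tsub_add_tsub_cancel h' h]

namespace WeightedGraph

variable {G : WeightedGraph}

theorem edist_comm (x y : G.Curve) : edist x y = edist y x := by
  have key : ∀ x y : G.Curve, edist x y ≤ edist y x := by
    intro x y
    have := le_add_edist (χ := fun z => edist x z) (fun e s t hs ht => ?_) y x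
    · simpa [edist_self] using this
    · refine (edist_triangle _ (G.pt e t) _).trans ?_
      gcongr
      rw [segLength_comm]
      exact edist_pt_le ht hs
  exact le_antisymm (key x y) (key y x)

variable (G) in
open Classical in
/-- Each edge `e ∈ S` is cut into two at the point `c e`. -/
noncomputable abbrev subdivide (S : Set G.E) (c : G.E → ℝ≥0∞) : WeightedGraph where
  V := G.V ⊕ S
  E := G.E ⊕ S
  finite_V := inferInstance
  finite_E := inferInstance
  src := Sum.elim (fun e => .inl (G.src e)) .inr
  tgt := Sum.elim (fun e => if h : e ∈ S then .inr ⟨e, h⟩ else .inl (G.tgt e))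
    (fun e => .inl (G.tgt e))
  len := Sum.elim (fun e => if e ∈ S then c e else G.len e) (fun e => G.len e - c e)

namespace subdivide

variable {S : Set G.E} {c : G.E → ℝ≥0∞}

theorem len_inl_of_mem {e : G.E} (h : e ∈ S) : (G.subdivide S c).len (.inl e) = c e := if_pos h

theorem len_inl_of_notMem {e : G.E} (h : e ∉ S) : (G.subdivide S c).len (.inl e) = G.len e :=
  if_neg h

theorem len_inr (e : S) : (G.subdivide S c).len (.inr e) = G.len e - c e := rfl

theorem tgt_inl_of_mem {e : G.E} (h : e ∈ S) : (G.subdivide S c).tgt (.inl e) = .inr ⟨e, h⟩ :=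
  dif_pos h

theorem tgt_inl_of_notMem {e : G.E} (h : e ∉ S) :
    (G.subdivide S c).tgt (.inl e) = .inl (G.tgt e) := dif_neg h

theorem src_inl (e : G.E) : (G.subdivide S c).src (.inl e) = .inl (G.src e) := rfl

theorem src_inr (e : S) : (G.subdivide S c).src (.inr e) = .inr e := rfl

theorem tgt_inr (e : S) : (G.subdivide S c).tgt (.inr e) = .inl (G.tgt e) := rfl

theorem isTropical (hG : G.IsTropical) (h₀ : ∀ e ∈ S, 0 < c e) (h₁ : ∀ e ∈ S, c e < G.len e) :
    (G.subdivide S c).IsTropical where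
  nonempty := hG.nonempty.map Sum.inl
  connected := by
    set R : (G.subdivide S c).V → (G.subdivide S c).V → Prop := fun a b =>
      ∃ e, (G.subdivide S c).src e = a ∧ (G.subdivide S c).tgt e = b
    have hS : ∀ e : S, Relation.EqvGen R (.inr e) (.inl (G.src e)) := fun e =>
      .symm _ _ (.rel _ _ ⟨.inl e, rfl, tgt_inl_of_mem e.2⟩)
    have hE : ∀ u v : G.V, Relation.EqvGen R (.inl u) (.inl v) := by
      intro u v
      induction hG.connected u v with
      | rel u v h =>
        obtain ⟨e, rfl, rfl⟩ := h
        by_cases he : e ∈ S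
        · exact .trans _ _ _ (.symm _ _ (hS ⟨e, he⟩)) (.rel _ _ ⟨.inr ⟨e, he⟩, rfl, rfl⟩)
        · exact .rel _ _ ⟨.inl e, rfl, tgt_inl_of_notMem he⟩
      | refl u => exact .refl _
      | symm _ _ _ ih => exact .symm _ _ ih
      | trans _ _ _ _ _ ih ih' => exact .trans _ _ _ ih ih'
    rintro (u | u) (v | v)
    · exact hE u v
    · exact .trans _ _ _ (hE _ _) (.symm _ _ (hS v))
    · exact .trans _ _ _ (hS u) (hE _ _)
    · exact .trans _ _ _ (hS u) (.trans _ _ _ (hE _ _) (.symm _ _ (hS v)))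
  len_pos := by
    rintro (e | e)
    · by_cases he : e ∈ S
      · rw [len_inl_of_mem he]; exact h₀ e he
      · rw [len_inl_of_notMem he]; exact hG.len_pos e
    · exact tsub_pos_of_lt (h₁ e e.2)
  not_loop_of_top := by
    rintro (e | e) he
    · by_cases h : e ∈ S
      · rw [len_inl_of_mem h] at he
        exact absurd he (h₁ e h).ne_top
      · rw [len_inl_of_notMem h] at he
        rw [tgt_inl_of_notMem h, src_inl]
        exact fun H => hG.not_loop_of_top e he (Sum.inl_injective H)
    · exact Sum.inr_ne_inl
  leaf_of_top := by
    -- Cut points are finite, so the infinite length of a cut edge passes to its second piece; this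
    -- piece, or the edge itself if uncut, is the only one at the end at infinity.
    have key : ∀ e, G.len e = ∞ → ∀ f : (G.subdivide S c).E,
        (G.subdivide S c).src f = .inl (G.tgt e) ∨ (G.subdivide S c).tgt f = .inl (G.tgt e) →
        (∃ h : e ∈ S, f = .inr ⟨e, h⟩) ∨ (e ∉ S ∧ f = .inl e) := by
      rintro e he (f | f) h
      · rw [src_inl] at h
        rcases h with h | h
        · have h := Sum.inl_injective h
          obtain rfl := hG.leaf_of_top e he f (.inl h)
          exact absurd h (hG.not_loop_of_top f he)
        · by_cases hf : f ∈ S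
          · rw [tgt_inl_of_mem hf] at h
            exact absurd h Sum.inr_ne_inl
          · rw [tgt_inl_of_notMem hf] at h
            obtain rfl := hG.leaf_of_top e he f (.inr (Sum.inl_injective h))
            exact .inr ⟨hf, rfl⟩
      · rcases h with h | h
        · exact absurd h Sum.inr_ne_inl
        · obtain rfl := hG.leaf_of_top e he f (.inr (Sum.inl_injective h))
          exact .inl ⟨f.2, rfl⟩
    rintro (e | e) he f hf
    · by_cases h : e ∈ S
      · rw [len_inl_of_mem h] at he
        exact absurd he (h₁ e h).ne_top
      · rw [len_inl_of_notMem h] at he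
        rw [tgt_inl_of_notMem h] at hf
        rcases key e he f hf with ⟨h', -⟩ | ⟨-, h'⟩
        · exact absurd h' h
        · exact h'
    · rw [len_inr] at he
      have he : G.len e = ∞ := by
        by_contra hne
        exact ENNReal.sub_ne_top hne he
      rcases key e he f hf with ⟨_, h'⟩ | ⟨h', -⟩
      · exact h'
      · exact absurd e.2 h'

section homeo

variable (h₁ : ∀ e ∈ S, c e < G.len e)

/-- The identification of a curve with its subdivision. -/
noncomputable def toCurve : (G.subdivide S c).Curve → G.Curve :=
  lift (Sum.elim G.vertex fun e => G.pt e (c e))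
    (Sum.elim (fun e t => G.pt e t) (fun e t => G.pt e (c e + t)))
    (by rintro (e | e) <;> simp [pt_zero])
    (by
      rintro (e | e)
      · by_cases h : e ∈ S
        · rw [len_inl_of_mem h, tgt_inl_of_mem h]; rfl
        · rw [len_inl_of_notMem h, tgt_inl_of_notMem h]; exact pt_len e
      · rw [len_inr, tgt_inr]
        simp [add_tsub_cancel_of_le (h₁ e e.2).le, pt_len])

open Classical in
/-- The identification of a curve with its subdivision, in the other direction. -/
noncomputable def ofCurve : G.Curve → (G.subdivide S c).Curve :=
  lift (fun v => (G.subdivide S c).vertex (.inl v))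
    (fun e t => if h : e ∈ S then
      if t ≤ c e then (G.subdivide S c).pt (.inl e) t else (G.subdivide S c).pt (.inr ⟨e, h⟩) (t - c e)
      else (G.subdivide S c).pt (.inl e) t)
    (fun e => by
      have := pt_zero (G := G.subdivide S c) (.inl e)
      simp [this])
    (fun e => by
      by_cases h : e ∈ S
      · have := pt_len (G := G.subdivide S c) (.inr ⟨e, h⟩)
        simpa [h, (h₁ e h).not_ge] using this
      · have := pt_len (G := G.subdivide S c) (.inl e)
        rw [len_inl_of_notMem h, tgt_inl_of_notMem h] at this
        simpa [h] using this)

theorem toCurve_inl {e : G.E} {t : ℝ≥0∞} (ht : t ≤ (G.subdivide S c).len (.inl e)) :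
    toCurve h₁ ((G.subdivide S c).pt (.inl e) t) = G.pt e t := lift_pt ht

theorem toCurve_inr {e : S} {t : ℝ≥0∞} (ht : t ≤ (G.subdivide S c).len (.inr e)) :
    toCurve h₁ ((G.subdivide S c).pt (.inr e) t) = G.pt e (c e + t) := lift_pt ht

theorem ofCurve_of_le {e : G.E} {t : ℝ≥0∞} (ht : t ≤ (G.subdivide S c).len (.inl e))
    (ht' : t ≤ G.len e) : ofCurve h₁ (G.pt e t) = (G.subdivide S c).pt (.inl e) t := by
  rw [ofCurve, lift_pt ht']
  by_cases h : e ∈ S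
  · rw [len_inl_of_mem h] at ht
    simp [h, ht]
  · simp [h]

theorem pt_inr_zero {e : G.E} (h : e ∈ S) : (G.subdivide S c).pt (.inr ⟨e, h⟩) 0 =
    (G.subdivide S c).pt (.inl e) (c e) := by
  have := pt_len (G := G.subdivide S c) (.inl e)
  rw [len_inl_of_mem h, tgt_inl_of_mem h] at this
  rw [this, pt_zero, src_inr]

theorem ofCurve_of_ge {e : S} {t : ℝ≥0∞} (ht : c e ≤ t) (ht' : t ≤ G.len e) :
    ofCurve h₁ (G.pt e t) = (G.subdivide S c).pt (.inr e) (t - c e) := by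
  rw [ofCurve, lift_pt ht']
  rcases eq_or_lt_of_le ht with rfl | h
  · simp [pt_inr_zero e.2]
  · simp [h]

theorem continuous_toCurve : Continuous (toCurve h₁) := by
  refine continuous_lift ?_
  rintro (e | e)
  · exact (continuous_pt e).continuousOn
  · exact ((continuous_pt e.1).comp (continuous_const.add continuous_id)).continuousOn

theorem continuous_ofCurve : Continuous (ofCurve h₁) := by
  refine continuous_lift fun e => Continuous.continuousOn ?_
  by_cases h : e ∈ S
  · simp only [h, dite_true]
    refine Continuous.if_le (continuous_pt _) ((continuous_pt _).comp
      (ENNReal.continuous_sub_right _)) continuous_id continuous_const ?_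
    rintro t rfl
    simp [pt_inr_zero h]
  · simp only [h, dite_false]
    exact continuous_pt _

theorem len_inl_le (h₁ : ∀ e ∈ S, c e < G.len e) (e : G.E) : (G.subdivide S c).len (.inl e) ≤ G.len e := by
  by_cases h : e ∈ S
  · rw [len_inl_of_mem h]; exact (h₁ e h).le
  · rw [len_inl_of_notMem h]

theorem add_le_len (h₁ : ∀ e ∈ S, c e < G.len e) {e : S} {t : ℝ≥0∞} (ht : t ≤ (G.subdivide S c).len (.inr e)) :
    c e + t ≤ G.len e := by
  rw [len_inr] at ht
  calc c e + t ≤ c e + (G.len e - c e) := by gcongr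
    _ = _ := add_tsub_cancel_of_le (h₁ e e.2).le

theorem ofCurve_toCurve (x : (G.subdivide S c).Curve) : ofCurve h₁ (toCurve h₁ x) = x := by
  rcases exists_pt_or_vertex x with ⟨v | e, rfl⟩ | ⟨e | e, t, -, ht, rfl⟩
  · rfl
  · change ofCurve h₁ (G.pt e (c e)) = _
    have h := len_inl_of_mem (c := c) e.2
    rw [ofCurve_of_le h₁ h.ge (h₁ e e.2).le, ← tgt_inl_of_mem e.2, ← pt_len, h]
  · rw [toCurve_inl h₁ ht.le, ofCurve_of_le h₁ ht.le (ht.le.trans (len_inl_le h₁ e))]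
  · rw [toCurve_inr h₁ ht.le, ofCurve_of_ge h₁ le_self_add (add_le_len h₁ ht.le),
      ENNReal.add_sub_cancel_left (h₁ e e.2).ne_top]

theorem toCurve_ofCurve (x : G.Curve) : toCurve h₁ (ofCurve h₁ x) = x := by
  rcases exists_pt_or_vertex x with ⟨v, rfl⟩ | ⟨e, t, -, ht, rfl⟩
  · rfl
  by_cases h : e ∈ S
  · rcases le_total t (c e) with h' | h'
    · rw [← len_inl_of_mem (c := c) h] at h'
      rw [ofCurve_of_le h₁ h' ht.le, toCurve_inl h₁ h']
    · rw [ofCurve_of_ge (e := ⟨e, h⟩) h₁ h' ht.le, toCurve_inr h₁, add_tsub_cancel_of_le h']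
      exact tsub_le_tsub_right ht.le _
  · have h' := ht.le
    rw [← len_inl_of_notMem (c := c) h] at h'
    rw [ofCurve_of_le h₁ h' ht.le, toCurve_inl h₁ h']

theorem edist_toCurve_le (x y : (G.subdivide S c).Curve) :
    edist (toCurve h₁ x) (toCurve h₁ y) ≤ edist x y := by
  refine edist_map_le ?_ x y
  rintro (e | e) s t hs ht
  · rw [toCurve_inl h₁ hs, toCurve_inl h₁ ht]
    exact edist_pt_le (hs.trans (len_inl_le h₁ e)) (ht.trans (len_inl_le h₁ e))
  · rw [toCurve_inr h₁ hs, toCurve_inr h₁ ht, ← segLength_add_left (h₁ e e.2).ne_top]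
    exact edist_pt_le (add_le_len h₁ hs) (add_le_len h₁ ht)

/-- Only a segment crossing the cut point needs an argument: its length is the sum of the lengths on
the two sides, so the triangle inequality through the cut point suffices. -/
theorem edist_ofCurve_le (x y : G.Curve) :
    edist (ofCurve h₁ x) (ofCurve h₁ y) ≤ edist x y := by
  refine edist_map_le ?_ x y
  intro e s t hs ht
  by_cases h : e ∈ S
  · have hlen := len_inl_of_mem (c := c) h
    have mixed : ∀ s t, t ≤ G.len e → s ≤ c e → c e ≤ t →
        edist (ofCurve h₁ (G.pt e s)) (ofCurve h₁ (G.pt e t)) ≤ segLength s t := by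
      intro s t ht hsc hct
      rw [ofCurve_of_le h₁ (hlen ▸ hsc) (hsc.trans (hct.trans ht)),
        ofCurve_of_ge (e := ⟨e, h⟩) h₁ hct ht, ← segLength_add_of_le hsc hct]
      refine (edist_triangle _ ((G.subdivide S c).pt (.inl e) (c e)) _).trans (add_le_add ?_ ?_)
      · exact edist_pt_le (hlen ▸ hsc) hlen.ge
      · have h0 : segLength (c e) t = segLength 0 (t - c e) := by
          rw [segLength_of_le hct, segLength_of_le zero_le, tsub_zero]
        rw [← pt_inr_zero h, h0]
        exact edist_pt_le zero_le (tsub_le_tsub_right ht _)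
    rcases le_total s (c e) with hsc | hsc <;> rcases le_total t (c e) with htc | htc
    · rw [ofCurve_of_le h₁ (hlen ▸ hsc) hs, ofCurve_of_le h₁ (hlen ▸ htc) ht]
      exact edist_pt_le (hlen ▸ hsc) (hlen ▸ htc)
    · exact mixed s t ht hsc htc
    · rw [edist_comm, segLength_comm]
      exact mixed t s hs htc hsc
    · rw [ofCurve_of_ge (e := ⟨e, h⟩) h₁ hsc hs, ofCurve_of_ge (e := ⟨e, h⟩) h₁ htc ht,
        ← segLength_sub_right (h₁ e h).ne_top hsc htc]
      exact edist_pt_le (tsub_le_tsub_right hs _) (tsub_le_tsub_right ht _)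
  · have hlen := len_inl_of_notMem (c := c) h
    rw [ofCurve_of_le h₁ (hlen ▸ hs) hs, ofCurve_of_le h₁ (hlen ▸ ht) ht]
    exact edist_pt_le (hlen ▸ hs) (hlen ▸ ht)

/-- The identification of a curve with its subdivision, as a homeomorphism. -/
noncomputable def homeo : (G.subdivide S c).Curve ≃ₜ G.Curve where
  toFun := toCurve h₁
  invFun := ofCurve h₁
  left_inv := ofCurve_toCurve h₁
  right_inv := toCurve_ofCurve h₁
  continuous_toFun := continuous_toCurve h₁
  continuous_invFun := continuous_ofCurve h₁

theorem edist_homeo (x y : (G.subdivide S c).Curve) :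
    edist (homeo h₁ x) (homeo h₁ y) = edist x y := by
  refine le_antisymm (edist_toCurve_le h₁ x y) ?_
  conv_lhs => rw [← ofCurve_toCurve h₁ x, ← ofCurve_toCurve h₁ y]
  exact edist_ofCurve_le h₁ _ _

end homeo

end subdivide

end WeightedGraph

/-! ### Existence of an admissible model -/

section Existence

universe u

variable {X : Type u} [TopologicalSpace X] [EDist X]

namespace Model

open WeightedGraph

variable (M : Model X)

/-- The model obtained by cutting each edge `e ∈ S` at the point `c e`. -/
noncomputable def subdivide (S : Set M.graph.E) (c : M.graph.E → ℝ≥0∞) (h₀ : ∀ e ∈ S, 0 < c e)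
    (h₁ : ∀ e ∈ S, c e < M.graph.len e) : Model X where
  graph := M.graph.subdivide S c
  isTropical := subdivide.isTropical M.isTropical h₀ h₁
  toHomeo := (subdivide.homeo h₁).trans M.toHomeo
  edist_eq a b := (M.edist_eq _ _).trans (subdivide.edist_homeo h₁ a b)

theorem exists_pt_or_vertex (x : X) : (∃ v, x = M.vertex v) ∨
    ∃ e t, 0 < t ∧ t < M.graph.len e ∧ x = M.pt e t := by
  rcases WeightedGraph.exists_pt_or_vertex (M.toHomeo.symm x) with ⟨v, h⟩ | ⟨e, t, h0, h1, h⟩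
  · exact .inl ⟨v, by rw [vertex, ← h, M.toHomeo.apply_symm_apply]⟩
  · exact .inr ⟨e, t, h0, h1, by rw [pt, ← h, M.toHomeo.apply_symm_apply]⟩

theorem pt_zero (e : M.graph.E) : M.pt e 0 = M.vertex (M.graph.src e) :=
  congrArg M.toHomeo (WeightedGraph.pt_zero e)

theorem pt_len (e : M.graph.E) : M.pt e (M.graph.len e) = M.vertex (M.graph.tgt e) :=
  congrArg M.toHomeo (WeightedGraph.pt_len e)

theorem vertex_injective : Function.Injective M.vertex :=
  M.toHomeo.injective.comp (WeightedGraph.vertex_injective M.isTropical.len_pos)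

theorem pt_ne_vertex {e : M.graph.E} {t : ℝ≥0∞} (h₀ : 0 < t) (h₁ : t < M.graph.len e)
    (v : M.graph.V) : M.pt e t ≠ M.vertex v := fun h =>
  WeightedGraph.pt_ne_vertex M.isTropical.len_pos h₀ h₁ v (M.toHomeo.injective h)

theorem pt_eq_pt_of_pos_of_lt {e f : M.graph.E} {s t : ℝ≥0∞} (hs : s ≤ M.graph.len e)
    (h₀ : 0 < t) (h₁ : t < M.graph.len f) (h : M.pt e s = M.pt f t) : e = f ∧ s = t :=
  WeightedGraph.pt_eq_pt_of_pos_of_lt M.isTropical.len_pos hs h₀ h₁ (M.toHomeo.injective h)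

theorem continuous_pt (e : M.graph.E) : Continuous (M.pt e) :=
  M.toHomeo.continuous.comp (WeightedGraph.continuous_pt e)

/-- Points are added one at a time: a point that is not yet a vertex is interior to a single edge,
which is cut there. -/
theorem exists_model_range_vertex {A : Set X} (hA : A.Finite) :
    ∃ M' : Model X, range M'.vertex = A ∪ range M.vertex := by
  induction A, hA using Set.Finite.induction_on with
  | empty => exact ⟨M, by simp⟩
  | @insert a A _ _ ih =>
    obtain ⟨M', hM'⟩ := ih
    rw [insert_union, ← hM']
    rcases M'.exists_pt_or_vertex a with ⟨v, rfl⟩ | ⟨e, t, h0, h1, rfl⟩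
    · exact ⟨M', (insert_eq_of_mem (mem_range_self v)).symm⟩
    · refine ⟨M'.subdivide {e} (fun _ => t) (fun _ _ => h0) (by rintro _ rfl; exact h1), ?_⟩
      ext x
      constructor
      · rintro ⟨v | ⟨_, rfl⟩, rfl⟩
        · exact .inr ⟨v, rfl⟩
        · exact .inl rfl
      · rintro (rfl | ⟨v, rfl⟩)
        · exact ⟨.inr ⟨e, rfl⟩, rfl⟩
        · exact ⟨.inl v, rfl⟩

variable {M}

theorem map_pt {σ : X ≃ₜ X} (hσ : ∀ x y, edist (σ x) (σ y) = edist x y)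
    (hv : ∀ v, ∃ w, σ (M.vertex v) = M.vertex w)
    (hv' : ∀ v, ∃ w, σ.symm (M.vertex v) = M.vertex w) (e : M.graph.E) :
    ∃ f, M.graph.len f = M.graph.len e ∧ ((∀ t ≤ M.graph.len e, σ (M.pt e t) = M.pt f t) ∨
      (M.graph.len e ≠ ∞ ∧ ∀ t ≤ M.graph.len e, σ (M.pt e t) = M.pt f (M.graph.len e - t))) := by
  set τ : M.graph.Curve ≃ₜ M.graph.Curve := (M.toHomeo.trans σ).trans M.toHomeo.symm with hτ
  have hτσ : ∀ x, M.toHomeo (τ x) = σ (M.toHomeo x) := fun x => by simp [hτ]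
  have h : IsVertexIsometry τ := by
    refine ⟨fun x y => ?_, fun v => ?_, fun v => ?_⟩
    · rw [← M.edist_eq, hτσ, hτσ, hσ, M.edist_eq]
    · obtain ⟨w, hw⟩ := hv v
      refine ⟨w, M.toHomeo.injective ?_⟩
      rw [hτσ]
      exact hw
    · obtain ⟨w, hw⟩ := hv' v
      refine ⟨w, τ.injective (M.toHomeo.injective ?_)⟩
      rw [τ.apply_symm_apply, hτσ]
      exact (σ.symm_apply_eq.1 hw)
  obtain ⟨f, hf, hf'⟩ := h.map_pt M.isTropical.len_pos e
  refine ⟨f, hf, hf'.imp (fun H t ht => ?_) (And.imp_right fun H t ht => ?_)⟩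
  · rw [pt, ← hτσ, H t ht, pt]
  · rw [pt, ← hτσ, H t ht, pt]

theorem edist_vertex_tgt_top {e : M.graph.E} (he : M.graph.len e = ∞) {y : X}
    (hy : y ≠ M.vertex (M.graph.tgt e)) : edist y (M.vertex (M.graph.tgt e)) = ∞ := by
  obtain ⟨z, rfl⟩ := M.toHomeo.surjective y
  rw [vertex, M.edist_eq]
  exact edist_pt_top M.isTropical he fun h => hy (congrArg M.toHomeo h)

/-- An end at infinity is at distance `∞` from every other point, whereas the source of the edge has
the point at position `1` within distance `1`. This is why infinite edges need no cutting. -/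
theorem src_not_mem_orbit_tgt_top {σ : X ≃ₜ X} (hσ : ∀ x y, edist (σ x) (σ y) = edist x y)
    {e : M.graph.E} (he : M.graph.len e = ∞) :
    σ (M.vertex (M.graph.src e)) ≠ M.vertex (M.graph.tgt e) := by
  intro h
  have h1 : (1 : ℝ≥0∞) < M.graph.len e := he ▸ ENNReal.one_lt_top
  have hne : M.pt e 1 ≠ M.vertex (M.graph.src e) := M.pt_ne_vertex one_pos h1 _
  have := edist_vertex_tgt_top he (y := σ (M.pt e 1)) (fun h' => hne (σ.injective (h'.trans h.symm)))
  rw [← h, hσ, ← M.pt_zero, pt, pt, M.edist_eq] at this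
  have h2 := edist_pt_le (G := M.graph) h1.le zero_le
  rw [this] at h2
  simp [segLength] at h2

theorem exists_isAdmissible (M₀ : Model X) (K : Subgroup (X ≃ₜ X)) (hK : K ≤ isometryGroup X)
    [Finite K] : ∃ M : Model X, M.IsAdmissible K := by
  -- Finiteness of `K` enters here: the smallest stable set containing the vertices is finite.
  have hfin : (⋃ σ : K, (σ : X ≃ₜ X) '' range M₀.vertex).Finite :=
    finite_iUnion fun σ => (finite_range _).image _
  obtain ⟨M, hM⟩ := M₀.exists_model_range_vertex hfin
  have hM : range M.vertex = ⋃ σ : K, (σ : X ≃ₜ X) '' range M₀.vertex := by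
    rw [hM]
    refine union_eq_self_of_subset_right fun x hx => mem_iUnion.2 ⟨1, x, hx, rfl⟩
  have hst : ∀ σ ∈ K, ∀ v, ∃ w, σ (M.vertex v) = M.vertex w := by
    intro σ hσ v
    have hv : M.vertex v ∈ range M.vertex := mem_range_self v
    rw [hM] at hv
    obtain ⟨τ, x, hx, h⟩ := mem_iUnion.1 hv
    have : σ (M.vertex v) ∈ range M.vertex := by
      rw [hM]
      exact mem_iUnion.2 ⟨⟨σ, hσ⟩ * τ, x, hx, by rw [← h]; rfl⟩
    obtain ⟨w, hw⟩ := this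
    exact ⟨w, hw.symm⟩
  set S : Set M.graph.E := {e | M.graph.len e ≠ ∞} with hS
  have hpos := M.isTropical.len_pos
  set c : M.graph.E → ℝ≥0∞ := fun e => M.graph.len e / 2 with hc
  have h₀ : ∀ e ∈ S, 0 < c e := fun e _ => ENNReal.half_pos (hpos e).ne'
  have h₁ : ∀ e ∈ S, c e < M.graph.len e := fun e he => ENNReal.half_lt_self (hpos e).ne' he
  -- A reversal also takes midpoint to midpoint, so cutting there keeps the vertex set stable.
  have hmid : ∀ σ ∈ K, ∀ e ∈ S, ∃ f ∈ S, σ (M.pt e (c e)) = M.pt f (c f) := by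
    intro σ hσ e he
    obtain ⟨f, hf, h | ⟨-, h⟩⟩ := map_pt (hK hσ) (hst σ hσ) (hst σ⁻¹ (K.inv_mem hσ)) e
    · exact ⟨f, by rwa [hS, mem_ofPred_eq, hf], by rw [h _ (h₁ e he).le]; simp only [hc, hf]⟩
    · refine ⟨f, by rwa [hS, mem_ofPred_eq, hf], ?_⟩
      rw [h _ (h₁ e he).le]
      simp only [hc, hf]
      rw [ENNReal.sub_half he]
  have hsep : ∀ σ ∈ K, ∀ v, ∀ e ∈ S, σ (M.vertex v) ≠ M.pt e (c e) := by
    intro σ hσ v e he h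
    obtain ⟨w, hw⟩ := hst σ hσ v
    exact M.pt_ne_vertex (h₀ e he) (h₁ e he) w (h.symm.trans hw)
  refine ⟨M.subdivide S c h₀ h₁, ⟨?_, ?_⟩⟩
  · rintro σ hσ (v | e)
    · obtain ⟨w, hw⟩ := hst σ hσ v
      exact ⟨.inl w, hw⟩
    · obtain ⟨f, hf, h⟩ := hmid σ hσ e e.2
      exact ⟨.inr ⟨f, hf⟩, h⟩
  · intro e h
    obtain ⟨σ, hσ, h⟩ := Quotient.exact h
    rcases e with e | e
    · by_cases he : e ∈ S
      · erw [subdivide.tgt_inl_of_mem he] at h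
        exact hsep σ hσ _ e he h
      · erw [subdivide.tgt_inl_of_notMem he] at h
        exact src_not_mem_orbit_tgt_top (hK hσ) (not_not.1 he) h
    · refine hsep σ⁻¹ (K.inv_mem hσ) (M.graph.tgt e) e e.2 ?_
      exact σ.symm_apply_eq.2 h.symm

end Model

end Existence

/-! ### Counting by fibres, and the quotient graph -/

theorem ENNReal.sub_lt_sub_left_of_le {a b c : ℝ≥0∞} (hc : c ≠ ∞) (h : a < b) (hb : b ≤ c) :
    c - b < c - a := by
  refine ENNReal.sub_lt_of_lt_add hb ?_
  conv_lhs => rw [← tsub_add_cancel_of_le (h.le.trans hb)]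
  exact ENNReal.add_lt_add_left (ENNReal.sub_ne_top hc) h

/-- The index type need not be finite, as the support lies in the image of `f`. This counts both
half-edges above a half-edge and points of a fibre of the quotient map. -/
theorem Nat.card_eq_finsum_card_fiber {A ι : Type*} [Finite A] (f : A → ι) (n : ι → ℕ)
    (h : ∀ i, n i = Nat.card {a // f a = i}) : ∑ᶠ i, n i = Nat.card A := by
  classical
  have := Fintype.ofFinite A
  rw [Nat.card_eq_fintype_card, ← Finset.card_univ, Finset.card_eq_sum_card_image f,
    finsum_eq_sum_of_support_subset (s := Finset.image f Finset.univ)]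
  · refine Finset.sum_congr rfl fun i _ => ?_
    rw [h i, Nat.card_eq_fintype_card, Fintype.card_subtype]
  · intro i hi
    rw [Function.mem_support, h i] at hi
    obtain ⟨a, rfl⟩ := (Nat.card_ne_zero.1 hi).1
    simp

section Quotient

universe u

variable {X : Type u} [TopologicalSpace X]

theorem Homeomorph.mul_image (a b : X ≃ₜ X) (s : Set X) : (a * b : X ≃ₜ X) '' s = a '' (b '' s) := by
  rw [← Set.image_comp]
  rfl

theorem Homeomorph.inv_image_eq {a : X ≃ₜ X} {s t : Set X} (h : a '' s = t) :
    (a⁻¹ : X ≃ₜ X) '' t = s := by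
  rw [← h, ← Homeomorph.mul_image, inv_mul_cancel]
  exact image_id s

variable [EDist X]

namespace Model

variable (M : Model X) (K : Subgroup (X ≃ₜ X))

theorem edgeSet_injective : Function.Injective M.edgeSet := by
  intro e f h
  obtain ⟨t, h0, h1⟩ := exists_between (M.isTropical.len_pos e)
  have : M.pt e t ∈ M.edgeSet f := h ▸ ⟨t, ⟨h0.le, h1.le⟩, rfl⟩
  obtain ⟨s, hs, hst⟩ := this
  exact (M.pt_eq_pt_of_pos_of_lt hs.2 h0 h1 hst).1.symm

/-- By connectedness, a vertex without edges would be the only vertex, the graph would have no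
edges, and the curve would be a singleton. -/
theorem exists_incident [Nontrivial X] (v : M.graph.V) :
    ∃ e, M.graph.src e = v ∨ M.graph.tgt e = v := by
  by_contra! hv
  have hV : ∀ w, w = v := by
    have key : ∀ a b, Relation.EqvGen (fun a b => ∃ e, M.graph.src e = a ∧ M.graph.tgt e = b) a b →
        (a = v ↔ b = v) := by
      intro a b h
      induction h with
      | rel a b h =>
        obtain ⟨e, rfl, rfl⟩ := h
        simp [hv e]
      | refl => rfl
      | symm _ _ _ ih => exact ih.symm
      | trans _ _ _ _ _ ih ih' => exact ih.trans ih'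
    exact fun w => (key v w (M.isTropical.connected v w)).1 rfl
  obtain ⟨x, hx⟩ := exists_ne (M.vertex v)
  rcases M.exists_pt_or_vertex x with ⟨w, rfl⟩ | ⟨e, -⟩
  · exact hx (by rw [hV w])
  · exact (hv e).1 (hV _)

theorem exists_pt [Nontrivial X] (x : X) : ∃ e, ∃ t ≤ M.graph.len e, x = M.pt e t := by
  rcases M.exists_pt_or_vertex x with ⟨v, rfl⟩ | ⟨e, t, -, h1, rfl⟩
  · obtain ⟨e, rfl | rfl⟩ := M.exists_incident v
    · exact ⟨e, 0, zero_le, (M.pt_zero e).symm⟩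
    · exact ⟨e, _, le_rfl, (M.pt_len e).symm⟩
  · exact ⟨e, t, h1.le, rfl⟩

instance [Finite K] (e : M.graph.E) : Finite (M.edgeStabilizer K e) :=
  Finite.of_injective (fun σ => (⟨σ, σ.2.1⟩ : K)) fun _ _ h =>
    Subtype.ext (congrArg (fun τ : K => (τ : X ≃ₜ X)) h)

variable {M K}

theorem natCard_edgeStabilizer_ne_zero [Finite K] (e : M.graph.E) :
    (Nat.card (M.edgeStabilizer K e) : ℝ≥0∞) ≠ 0 :=
  Nat.cast_ne_zero.2 Nat.card_pos.ne'

theorem vertexClass_eq_iff {v w : M.graph.V} :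
    M.vertexClass K v = M.vertexClass K w ↔ ∃ σ ∈ K, σ (M.vertex v) = M.vertex w :=
  Quotient.eq (r := M.vertexSetoid K)

theorem edgeClass_eq_iff {e f : M.graph.E} :
    M.edgeClass K e = M.edgeClass K f ↔ ∃ σ ∈ K, σ '' M.edgeSet e = M.edgeSet f :=
  Quotient.eq (r := M.edgeSetoid K)

/-- The elements carrying `e` to `f` form a torsor under the stabilizer of `f` by left
multiplication. Right multiplication by the stabilizer of `e` gives the next lemma. -/
theorem card_transporter {e f : M.graph.E} {σ₀ : X ≃ₜ X} (hσ₀ : σ₀ ∈ K)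
    (h₀ : σ₀ '' M.edgeSet e = M.edgeSet f) :
    Nat.card (M.edgeStabilizer K f) =
      Nat.card {σ : X ≃ₜ X // σ ∈ K ∧ σ '' M.edgeSet e = M.edgeSet f} := by
  refine Nat.card_congr
    { toFun := fun τ => ⟨τ * σ₀, K.mul_mem τ.2.1 hσ₀, ?_⟩
      invFun := fun σ => ⟨σ * σ₀⁻¹, K.mul_mem σ.2.1 (K.inv_mem hσ₀), ?_⟩
      left_inv := fun τ => Subtype.ext (mul_inv_cancel_right _ _)
      right_inv := fun σ => Subtype.ext (inv_mul_cancel_right _ _) }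
  · rw [Homeomorph.mul_image, h₀]
    exact τ.2.2
  · rw [Homeomorph.mul_image, Homeomorph.inv_image_eq h₀, σ.2.2]

theorem card_edgeStabilizer_eq {e f : M.graph.E} (h : M.edgeClass K e = M.edgeClass K f) :
    Nat.card (M.edgeStabilizer K e) = Nat.card (M.edgeStabilizer K f) := by
  obtain ⟨σ₀, hσ₀, h₀⟩ := edgeClass_eq_iff.1 h
  rw [card_transporter hσ₀ h₀]
  refine Nat.card_congr
    { toFun := fun τ => ⟨σ₀ * τ, K.mul_mem hσ₀ τ.2.1, ?_⟩
      invFun := fun σ => ⟨σ₀⁻¹ * σ, K.mul_mem (K.inv_mem hσ₀) σ.2.1, ?_⟩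
      left_inv := fun τ => Subtype.ext (inv_mul_cancel_left _ _)
      right_inv := fun σ => Subtype.ext (mul_inv_cancel_left _ _) }
  · rw [Homeomorph.mul_image, τ.2.2, h₀]
  · rw [Homeomorph.mul_image, σ.2.2, Homeomorph.inv_image_eq h₀]

theorem edgeClass_out (q : (M.quotientGraph K).E) :
    M.edgeClass K (Quotient.out (s := M.edgeSetoid K) q) = q := Quotient.out_eq _

namespace IsAdmissible

theorem map_edge (hM : M.IsAdmissible K) (hK : K ≤ isometryGroup X) {σ : X ≃ₜ X} (hσ : σ ∈ K)
    (e : M.graph.E) : ∃ f, σ '' M.edgeSet e = M.edgeSet f ∧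
    M.graph.len f = M.graph.len e ∧ ((∀ t ≤ M.graph.len e, σ (M.pt e t) = M.pt f t) ∨
      (M.graph.len e ≠ ∞ ∧ ∀ t ≤ M.graph.len e, σ (M.pt e t) = M.pt f (M.graph.len e - t))) := by
  obtain ⟨f, hf, h⟩ := map_pt (hK hσ) (hM.stable σ hσ) (hM.stable σ⁻¹ (K.inv_mem hσ)) e
  refine ⟨f, ?_, hf, h⟩
  rw [edgeSet, edgeSet, ← image_comp, hf]
  rcases h with h | ⟨h', h⟩
  · exact image_congr fun t ht => h t ht.2
  · ext x
    constructor
    · rintro ⟨t, ht, rfl⟩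
      exact ⟨_, ⟨zero_le, tsub_le_self⟩, (h t ht.2).symm⟩
    · rintro ⟨t, ht, rfl⟩
      refine ⟨M.graph.len e - t, ⟨zero_le, tsub_le_self⟩, ?_⟩
      rw [Function.comp_apply, h _ tsub_le_self, ENNReal.sub_sub_cancel h' ht.2]

/-- The classes of the ends are recorded because, by looplessness, they decide which of the two
orientations occurs. -/
theorem map_pt_of_image (hM : M.IsAdmissible K) (hK : K ≤ isometryGroup X) {σ : X ≃ₜ X} (hσ : σ ∈ K)
    {e f : M.graph.E} (hf : σ '' M.edgeSet e = M.edgeSet f) : M.graph.len f = M.graph.len e ∧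
      ((M.vertexClass K (M.graph.src e) = M.vertexClass K (M.graph.src f) ∧
        M.vertexClass K (M.graph.tgt e) = M.vertexClass K (M.graph.tgt f) ∧
        ∀ t ≤ M.graph.len e, σ (M.pt e t) = M.pt f t) ∨
      (M.vertexClass K (M.graph.src e) = M.vertexClass K (M.graph.tgt f) ∧
        M.vertexClass K (M.graph.tgt e) = M.vertexClass K (M.graph.src f) ∧ M.graph.len e ≠ ∞ ∧
        ∀ t ≤ M.graph.len e, σ (M.pt e t) = M.pt f (M.graph.len e - t))) := by
  obtain ⟨f', hf', hlen, h⟩ := hM.map_edge hK hσ e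
  obtain rfl := M.edgeSet_injective (hf'.symm.trans hf)
  refine ⟨hlen, h.imp (fun h => ⟨?_, ?_, h⟩) (fun h => ⟨?_, ?_, h⟩)⟩
  · refine vertexClass_eq_iff.2 ⟨σ, hσ, ?_⟩
    rw [← M.pt_zero, ← M.pt_zero, h 0 zero_le]
  · refine vertexClass_eq_iff.2 ⟨σ, hσ, ?_⟩
    rw [← M.pt_len, ← M.pt_len, h _ le_rfl, hlen]
  · refine vertexClass_eq_iff.2 ⟨σ, hσ, ?_⟩
    rw [← M.pt_zero, ← M.pt_len, h.2 0 zero_le, hlen, tsub_zero]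
  · refine vertexClass_eq_iff.2 ⟨σ, hσ, ?_⟩
    rw [← M.pt_len, ← M.pt_zero, h.2 _ le_rfl, tsub_self]

theorem loopless_edge (hM : M.IsAdmissible K) (e : M.graph.E) :
    M.graph.src e ≠ M.graph.tgt e := fun h => hM.loopless e (congrArg _ h)

theorem loopless_quotient (hM : M.IsAdmissible K) (q : (M.quotientGraph K).E) :
    (M.quotientGraph K).src q ≠ (M.quotientGraph K).tgt q := hM.loopless _

theorem len_edgeClass (hM : M.IsAdmissible K) (hK : K ≤ isometryGroup X) (e : M.graph.E) :
    (M.quotientGraph K).len (M.edgeClass K e) =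
      Nat.card (M.edgeStabilizer K e) * M.graph.len e := by
  have h : M.edgeClass K (Quotient.out (s := M.edgeSetoid K) (M.edgeClass K e)) = M.edgeClass K e :=
    edgeClass_out _
  change Nat.card (M.edgeStabilizer K (Quotient.out (s := M.edgeSetoid K) (M.edgeClass K e))) *
    M.graph.len (Quotient.out (s := M.edgeSetoid K) (M.edgeClass K e)) = _
  rw [card_edgeStabilizer_eq h]
  obtain ⟨σ, hσ, h'⟩ := edgeClass_eq_iff.1 h
  rw [(hM.map_pt_of_image hK hσ h').1]

theorem ends_edgeClass (hM : M.IsAdmissible K) (hK : K ≤ isometryGroup X) (e : M.graph.E) :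
    (M.vertexClass K (M.graph.src e) = (M.quotientGraph K).src (M.edgeClass K e) ∧
      M.vertexClass K (M.graph.tgt e) = (M.quotientGraph K).tgt (M.edgeClass K e)) ∨
    (M.vertexClass K (M.graph.src e) ≠ (M.quotientGraph K).src (M.edgeClass K e) ∧
      M.vertexClass K (M.graph.src e) = (M.quotientGraph K).tgt (M.edgeClass K e) ∧
      M.vertexClass K (M.graph.tgt e) = (M.quotientGraph K).src (M.edgeClass K e) ∧
      M.graph.len e ≠ ∞) := by
  obtain ⟨σ, hσ, h⟩ := edgeClass_eq_iff.1 (edgeClass_out (M.edgeClass K e)).symm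
  rcases (hM.map_pt_of_image hK hσ h).2 with ⟨h1, h2, -⟩ | ⟨h1, h2, h3, -⟩
  · exact .inl ⟨h1, h2⟩
  · exact .inr ⟨fun h' => hM.loopless_quotient (M.edgeClass K e) (h'.symm.trans h1), h1, h2, h3⟩

theorem len_quotient_pos [Finite K] (q : (M.quotientGraph K).E) : 0 < (M.quotientGraph K).len q :=
  ENNReal.mul_pos (natCard_edgeStabilizer_ne_zero _) (M.isTropical.len_pos _).ne'

theorem isTropical_quotient [Finite K] (hM : M.IsAdmissible K) (hK : K ≤ isometryGroup X) :
    (M.quotientGraph K).IsTropical where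
  nonempty := M.isTropical.nonempty.map (M.vertexClass K)
  connected := by
    intro p q
    induction p using Quotient.inductionOn with | _ u
    induction q using Quotient.inductionOn with | _ v
    induction M.isTropical.connected u v with
    | rel u v h =>
      obtain ⟨e, rfl, rfl⟩ := h
      rcases hM.ends_edgeClass hK e with ⟨h1, h2⟩ | ⟨-, h1, h2, -⟩
      · exact .rel _ _ ⟨M.edgeClass K e, h1.symm, h2.symm⟩
      · exact .symm _ _ (.rel _ _ ⟨M.edgeClass K e, h2.symm, h1.symm⟩)
    | refl u => exact .refl _
    | symm _ _ _ ih => exact .symm _ _ ih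
    | trans _ _ _ _ _ ih ih' => exact .trans _ _ _ ih ih'
  len_pos := len_quotient_pos
  not_loop_of_top q _ := hM.loopless_quotient q
  leaf_of_top := by
    intro q hq p hp
    have hq' : M.graph.len (Quotient.out (s := M.edgeSetoid K) q) = ∞ := by
      by_contra hne
      exact ENNReal.mul_ne_top (ENNReal.natCast_ne_top _) hne hq
    rw [← edgeClass_out p, ← edgeClass_out q, edgeClass_eq_iff]
    rcases hp with hp | hp <;> obtain ⟨σ, hσ, h⟩ := vertexClass_eq_iff.1 hp
    all_goals
      -- A translate `g` of the representative of `p` reaches the actual vertex at infinity of the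
      -- representative of `q`, so the leaf condition upstairs applies to it.
      obtain ⟨g, hg, hlen, hg'⟩ := hM.map_edge hK hσ (Quotient.out (s := M.edgeSetoid K) p)
      have := M.isTropical.leaf_of_top _ hq' g ?_
      · exact ⟨σ, hσ, this ▸ hg⟩
    · rcases hg' with hg' | ⟨-, hg'⟩
      · refine .inl (M.vertex_injective ?_)
        rw [← h, ← M.pt_zero, ← M.pt_zero, hg' 0 zero_le]
      · refine .inr (M.vertex_injective ?_)
        rw [← h, ← M.pt_zero, ← M.pt_len, hg' 0 zero_le, hlen, tsub_zero]
    · rcases hg' with hg' | ⟨-, hg'⟩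
      · refine .inr (M.vertex_injective ?_)
        rw [← h, ← M.pt_len, ← M.pt_len, hg' _ le_rfl, hlen]
      · refine .inl (M.vertex_injective ?_)
        rw [← h, ← M.pt_len, ← M.pt_zero, hg' _ le_rfl, tsub_self]

end IsAdmissible

end Model

end Quotient

/-! ### The quotient map and its fibres -/

section QuotientMap

universe u

variable {X : Type u} [TopologicalSpace X] [EDist X]

namespace Model

variable (M : Model X) (K : Subgroup (X ≃ₜ X))

open Classical in
/-- The position on the edge `[e]` of the image of the point at position `t` on the edge `e`. -/
noncomputable def coord (e : M.graph.E) (t : ℝ≥0∞) : ℝ≥0∞ :=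
  if M.vertexClass K (M.graph.src e) = (M.quotientGraph K).src (M.edgeClass K e) then
    Nat.card (M.edgeStabilizer K e) * t
  else (M.quotientGraph K).len (M.edgeClass K e) - Nat.card (M.edgeStabilizer K e) * t

variable {M K}

theorem IsQuotientMap.map_pt_coord {φ : X → (M.quotientGraph K).Curve} (hφ : M.IsQuotientMap K φ)
    {e : M.graph.E} {t : ℝ≥0∞} (ht : t ≤ M.graph.len e) :
    φ (M.pt e t) = (M.quotientGraph K).pt (M.edgeClass K e) (M.coord K e t) := by
  rw [hφ.map_pt e t ht, coord]
  split_ifs <;> rfl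

theorem IsQuotientMap.ext [Nontrivial X] {φ ψ : X → (M.quotientGraph K).Curve}
    (hφ : M.IsQuotientMap K φ) (hψ : M.IsQuotientMap K ψ) : φ = ψ := by
  ext x
  obtain ⟨e, t, ht, rfl⟩ := M.exists_pt x
  rw [hφ.map_pt_coord ht, hψ.map_pt_coord ht]

namespace IsAdmissible

/-- The quotient map respects the orientation of `e`, and is a dilation on it. -/
structure CoordForward (M : Model X) (K : Subgroup (X ≃ₜ X)) (e : M.graph.E) : Prop where
  src_eq : M.vertexClass K (M.graph.src e) = (M.quotientGraph K).src (M.edgeClass K e)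
  tgt_eq : M.vertexClass K (M.graph.tgt e) = (M.quotientGraph K).tgt (M.edgeClass K e)
  coord_eq : ∀ t, M.coord K e t = Nat.card (M.edgeStabilizer K e) * t
  coord_zero : M.coord K e 0 = 0
  coord_len : M.coord K e (M.graph.len e) = (M.quotientGraph K).len (M.edgeClass K e)
  strictMonoOn : StrictMonoOn (M.coord K e) (Iic (M.graph.len e))

/-- The quotient map reverses the orientation of `e`, and is a dilation on it. -/
structure CoordBackward (M : Model X) (K : Subgroup (X ≃ₜ X)) (e : M.graph.E) : Prop where
  src_eq : M.vertexClass K (M.graph.src e) = (M.quotientGraph K).tgt (M.edgeClass K e)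
  tgt_eq : M.vertexClass K (M.graph.tgt e) = (M.quotientGraph K).src (M.edgeClass K e)
  len_ne_top : (M.quotientGraph K).len (M.edgeClass K e) ≠ ∞
  coord_eq : ∀ t, M.coord K e t =
    (M.quotientGraph K).len (M.edgeClass K e) - Nat.card (M.edgeStabilizer K e) * t
  coord_zero : M.coord K e 0 = (M.quotientGraph K).len (M.edgeClass K e)
  coord_len : M.coord K e (M.graph.len e) = 0
  strictAntiOn : StrictAntiOn (M.coord K e) (Iic (M.graph.len e))

section

variable [Finite K] (hM : M.IsAdmissible K) (hK : K ≤ isometryGroup X)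

include hM hK

theorem coord_cases (e : M.graph.E) : CoordForward M K e ∨ CoordBackward M K e := by
  have hk := natCard_edgeStabilizer_ne_zero (M := M) (K := K) e
  have hk' := ENNReal.natCast_ne_top (Nat.card (M.edgeStabilizer K e))
  have hlen := hM.len_edgeClass hK e
  rcases hM.ends_edgeClass hK e with ⟨h1, h2⟩ | ⟨h, h1, h2, h3⟩
  · have hc : ∀ t, M.coord K e t = Nat.card (M.edgeStabilizer K e) * t := fun t => if_pos h1
    refine .inl ⟨h1, h2, hc, by rw [hc, mul_zero], by rw [hc, hlen], fun s _ t _ hst => ?_⟩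
    rw [hc, hc]
    exact ENNReal.mul_lt_mul_right hk hk' hst
  · have hc : ∀ t, M.coord K e t = (M.quotientGraph K).len (M.edgeClass K e) -
      Nat.card (M.edgeStabilizer K e) * t := fun t => if_neg h
    have htop : (M.quotientGraph K).len (M.edgeClass K e) ≠ ∞ :=
      hlen ▸ ENNReal.mul_ne_top hk' h3
    refine .inr ⟨h1, h2, htop, hc, by rw [hc, mul_zero, tsub_zero], by rw [hc, hlen, tsub_self],
      fun s _ t ht hst => ?_⟩
    rw [hc, hc]
    refine ENNReal.sub_lt_sub_left_of_le htop (ENNReal.mul_lt_mul_right hk hk' hst) ?_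
    rw [hlen]
    gcongr
    exact ht

theorem continuous_coord (e : M.graph.E) : Continuous (M.coord K e) := by
  have h := ENNReal.continuous_const_mul
    (ENNReal.natCast_ne_top (Nat.card (M.edgeStabilizer K e)))
  rcases hM.coord_cases hK e with H | H
  · rw [funext H.coord_eq]
    exact h
  · rw [funext H.coord_eq]
    exact (ENNReal.continuous_sub_left H.len_ne_top).comp h

theorem coord_injOn (e : M.graph.E) : InjOn (M.coord K e) (Iic (M.graph.len e)) := by
  rcases hM.coord_cases hK e with H | H
  · exact H.strictMonoOn.injOn
  · exact H.strictAntiOn.injOn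

theorem coord_le {e : M.graph.E} {t : ℝ≥0∞} (ht : t ≤ M.graph.len e) :
    M.coord K e t ≤ (M.quotientGraph K).len (M.edgeClass K e) := by
  rcases hM.coord_cases hK e with H | H
  · rw [← H.coord_len]
    exact H.strictMonoOn.monotoneOn ht self_mem_Iic ht
  · rw [H.coord_eq]
    exact tsub_le_self

theorem coord_mem_Ioo {e : M.graph.E} {t : ℝ≥0∞} (ht : t ∈ Ioo 0 (M.graph.len e)) :
    M.coord K e t ∈ Ioo 0 ((M.quotientGraph K).len (M.edgeClass K e)) := by
  rcases hM.coord_cases hK e with H | H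
  · rw [← H.coord_len, ← H.coord_zero]
    exact ⟨H.strictMonoOn (mem_Iic.2 zero_le) ht.2.le ht.1, H.strictMonoOn ht.2.le self_mem_Iic ht.2⟩
  · rw [← H.coord_len, ← H.coord_zero]
    exact ⟨H.strictAntiOn ht.2.le self_mem_Iic ht.2, H.strictAntiOn (mem_Iic.2 zero_le) ht.2.le ht.1⟩

theorem segLength_coord {e : M.graph.E} {s t : ℝ≥0∞} (hs : s ≤ M.graph.len e)
    (ht : t ≤ M.graph.len e) : segLength (M.coord K e s) (M.coord K e t) =
      Nat.card (M.edgeStabilizer K e) * segLength s t := by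
  have hk' := ENNReal.natCast_ne_top (Nat.card (M.edgeStabilizer K e))
  have hlen := hM.len_edgeClass hK e
  rw [segLength, segLength, mul_add, ENNReal.mul_sub fun _ _ => hk', ENNReal.mul_sub fun _ _ => hk']
  rcases hM.coord_cases hK e with H | H
  · rw [H.coord_eq, H.coord_eq]
  · rw [H.coord_eq, H.coord_eq, ENNReal.sub_sub_sub_cancel_left H.len_ne_top,
      ENNReal.sub_sub_sub_cancel_left H.len_ne_top, add_comm]
    all_goals
      rw [hlen]
      gcongr

/-- If `σ` preserves the reference orientations, `e` and `f` are oriented alike relative to their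
class; if it reverses them, oppositely. Other combinations would make a loop in the quotient. In the
second case the two reflections cancel. -/
theorem coord_map {σ : X ≃ₜ X} (hσ : σ ∈ K) {e f : M.graph.E}
    (hf : σ '' M.edgeSet e = M.edgeSet f) {t : ℝ≥0∞} (ht : t ≤ M.graph.len e) :
    ∃ s ≤ M.graph.len f, σ (M.pt e t) = M.pt f s ∧ M.coord K f s = M.coord K e t := by
  have hq : M.edgeClass K e = M.edgeClass K f := edgeClass_eq_iff.2 ⟨σ, hσ, hf⟩
  have hk := card_edgeStabilizer_eq hq
  have hlen := hM.len_edgeClass hK e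
  have hsub : ∀ t ≤ M.graph.len e, M.graph.len e ≠ ∞ →
      Nat.card (M.edgeStabilizer K e) * (M.graph.len e - t) =
        (M.quotientGraph K).len (M.edgeClass K e) - Nat.card (M.edgeStabilizer K e) * t := by
    intro t ht _
    rw [ENNReal.mul_sub fun _ _ => ENNReal.natCast_ne_top _, hlen]
  obtain ⟨hl, ⟨h1, h2, h⟩ | ⟨h1, h2, hne, h⟩⟩ := hM.map_pt_of_image hK hσ hf
  · refine ⟨t, hl ▸ ht, h t ht, ?_⟩
    have hne' := hM.loopless_quotient (M.edgeClass K e)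
    rcases hM.coord_cases hK e with H | H <;> rcases hM.coord_cases hK f with H' | H'
    · rw [H.coord_eq, H'.coord_eq, hk]
    · exact absurd (H.src_eq.symm.trans (h1.trans H'.src_eq)) (hq ▸ hne')
    · exact absurd (H'.src_eq.symm.trans (h1.symm.trans H.src_eq)) (hq ▸ hne')
    · rw [H.coord_eq, H'.coord_eq, hk, hq]
  · refine ⟨M.graph.len e - t, hl ▸ tsub_le_self, h t ht, ?_⟩
    have hne' := hM.loopless_quotient (M.edgeClass K e)
    rcases hM.coord_cases hK e with H | H <;> rcases hM.coord_cases hK f with H' | H'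
    · exact absurd (H'.src_eq.symm.trans (h2.symm.trans H.tgt_eq)) (hq ▸ hne')
    · rw [H.coord_eq, H'.coord_eq, ← hq, ← hk, hsub t ht hne]
      refine ENNReal.sub_sub_cancel (hq ▸ H'.len_ne_top) ?_
      rw [hlen]
      gcongr
    · rw [H.coord_eq, H'.coord_eq, ← hk, hsub t ht hne]
    · exact absurd (H.tgt_eq.symm.trans (h2.trans H'.src_eq)) (hq ▸ hne')

theorem exists_isQuotientMap :
    ∃ φ : X → (M.quotientGraph K).Curve, M.IsQuotientMap K φ ∧ Continuous φ := by
  have h₀ : ∀ e, (M.quotientGraph K).pt (M.edgeClass K e) (M.coord K e 0) =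
      (M.quotientGraph K).vertex (M.vertexClass K (M.graph.src e)) := by
    intro e
    rcases hM.coord_cases hK e with H | H
    · rw [H.coord_zero, WeightedGraph.pt_zero, H.src_eq]
    · rw [H.coord_zero, WeightedGraph.pt_len, H.src_eq]
  have h₁ : ∀ e, (M.quotientGraph K).pt (M.edgeClass K e) (M.coord K e (M.graph.len e)) =
      (M.quotientGraph K).vertex (M.vertexClass K (M.graph.tgt e)) := by
    intro e
    rcases hM.coord_cases hK e with H | H
    · rw [H.coord_len, WeightedGraph.pt_len, H.tgt_eq]
    · rw [H.coord_len, WeightedGraph.pt_zero, H.tgt_eq]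
  refine ⟨WeightedGraph.lift (fun v => (M.quotientGraph K).vertex (M.vertexClass K v))
    (fun e t => (M.quotientGraph K).pt (M.edgeClass K e) (M.coord K e t)) h₀ h₁ ∘ M.toHomeo.symm,
    ⟨fun v => ?_, fun e t ht => ?_⟩, ?_⟩
  · rw [Function.comp_apply, vertex, M.toHomeo.symm_apply_apply, WeightedGraph.lift_vertex]
  · rw [Function.comp_apply, pt, M.toHomeo.symm_apply_apply, WeightedGraph.lift_pt ht, coord]
    split_ifs <;> rfl
  · refine (WeightedGraph.continuous_lift fun e => Continuous.continuousOn ?_).comp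
      M.toHomeo.symm.continuous
    exact (WeightedGraph.continuous_pt _).comp (hM.continuous_coord hK e)

variable {φ : X → (M.quotientGraph K).Curve} (hφ : M.IsQuotientMap K φ)

include hφ

/-- Edges are not folded, because the two ends of `[e]` differ. Consequently an element of `K`
stabilizing an edge fixes it pointwise. -/
theorem quotientMap_injOn_edge (e : M.graph.E) : InjOn φ (M.edgeSet e) := by
  rintro _ ⟨s, hs, rfl⟩ _ ⟨t, ht, rfl⟩ h
  rw [hφ.map_pt_coord hs.2, hφ.map_pt_coord ht.2] at h
  have := WeightedGraph.pt_injOn len_quotient_pos (hM.loopless_quotient _)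
    (hM.coord_le hK hs.2) (hM.coord_le hK ht.2) h
  rw [hM.coord_injOn hK e hs.2 ht.2 this]

/-- For interior points with the same image, some `σ` carries one edge to the other; invariance of
`coord` and its injectivity then force `σ` to match the points. -/
theorem quotientMap_eq_iff [Nontrivial X] (x y : X) : φ x = φ y ↔ ∃ σ ∈ K, σ x = y := by
  constructor
  · intro h
    rcases M.exists_pt_or_vertex x with ⟨v, rfl⟩ | ⟨e, t, h0, h1, rfl⟩ <;>
      rcases M.exists_pt_or_vertex y with ⟨w, rfl⟩ | ⟨f, s, h0', h1', rfl⟩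
    · rw [hφ.map_vertex, hφ.map_vertex] at h
      exact vertexClass_eq_iff.1 (WeightedGraph.vertex_injective len_quotient_pos h)
    · have hc := hM.coord_mem_Ioo hK ⟨h0', h1'⟩
      rw [hφ.map_vertex, hφ.map_pt_coord h1'.le] at h
      exact absurd h.symm (WeightedGraph.pt_ne_vertex len_quotient_pos hc.1 hc.2 _)
    · have hc := hM.coord_mem_Ioo hK ⟨h0, h1⟩
      rw [hφ.map_vertex, hφ.map_pt_coord h1.le] at h
      exact absurd h (WeightedGraph.pt_ne_vertex len_quotient_pos hc.1 hc.2 _)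
    · have hc := hM.coord_mem_Ioo hK ⟨h0', h1'⟩
      have h' := h
      rw [hφ.map_pt_coord h1.le, hφ.map_pt_coord h1'.le] at h'
      obtain ⟨hq, hcc⟩ := WeightedGraph.pt_eq_pt_of_pos_of_lt len_quotient_pos
        (hM.coord_le hK h1.le) hc.1 hc.2 h'
      obtain ⟨σ, hσ, hf⟩ := edgeClass_eq_iff.1 hq
      obtain ⟨s', hs', hσs, hcoord⟩ := hM.coord_map hK hσ hf h1.le
      refine ⟨σ, hσ, ?_⟩
      rw [hσs, hM.coord_injOn hK f hs' h1'.le (hcoord.trans hcc)]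
  · rintro ⟨σ, hσ, rfl⟩
    obtain ⟨e, t, ht, rfl⟩ := M.exists_pt x
    obtain ⟨f, hf, -⟩ := hM.map_edge hK hσ e
    obtain ⟨s, hs, hσs, hcoord⟩ := hM.coord_map hK hσ hf ht
    rw [hσs, hφ.map_pt_coord ht, hφ.map_pt_coord hs, hcoord, edgeClass_eq_iff.2 ⟨σ, hσ, hf⟩]

theorem exists_edge_over {q : (M.quotientGraph K).E} {u : ℝ≥0∞}
    (hu : u ≤ (M.quotientGraph K).len q) :
    ∃ e, M.edgeClass K e = q ∧ ∃ t ≤ M.graph.len e, M.coord K e t = u ∧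
      φ (M.pt e t) = (M.quotientGraph K).pt q u := by
  obtain ⟨e, rfl⟩ : ∃ e, M.edgeClass K e = q := ⟨_, edgeClass_out q⟩
  obtain ⟨t, ht, hc⟩ : ∃ t ≤ M.graph.len e, M.coord K e t = u := by
    have hk := natCard_edgeStabilizer_ne_zero (M := M) (K := K) e
    have hk' := ENNReal.natCast_ne_top (Nat.card (M.edgeStabilizer K e))
    have hlen := hM.len_edgeClass hK e
    have hdiv : ∀ v ≤ (M.quotientGraph K).len (M.edgeClass K e),
        v / Nat.card (M.edgeStabilizer K e) ≤ M.graph.len e := fun v hv => by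
      refine ENNReal.div_le_of_le_mul' ?_
      rwa [← hlen]
    rcases hM.coord_cases hK e with H | H
    · exact ⟨_, hdiv u hu, by rw [H.coord_eq, ENNReal.mul_div_cancel hk hk']⟩
    · refine ⟨_, hdiv _ (tsub_le_self (b := u)), ?_⟩
      rw [H.coord_eq, ENNReal.mul_div_cancel hk hk', ENNReal.sub_sub_cancel H.len_ne_top hu]
  exact ⟨e, rfl, t, ht, hc, by rw [hφ.map_pt_coord ht, hc]⟩

theorem quotientMap_surjective : Function.Surjective φ := by
  intro y
  rcases WeightedGraph.exists_pt_or_vertex y with ⟨v, rfl⟩ | ⟨q, u, -, hu, rfl⟩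
  · induction v using Quotient.inductionOn with | _ v
    exact ⟨M.vertex v, hφ.map_vertex v⟩
  · obtain ⟨e, -, t, -, -, h⟩ := hM.exists_edge_over hK hφ hu.le
    exact ⟨_, h⟩

theorem preimage_relInterior (hG' : (M.quotientGraph K).IsTropical)
    (q : (M.quotientGraph K).E) :
    φ ⁻¹' ((M.quotientGraph K).selfModel hG').relInterior q =
      ⋃ e ∈ {e | M.edgeClass K e = q}, M.relInterior e := by
  have hpos : ∀ q, 0 < (M.quotientGraph K).len q := len_quotient_pos
  ext x
  have himg : ((M.quotientGraph K).selfModel hG').relInterior q =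
    (M.quotientGraph K).pt q '' Ioo 0 ((M.quotientGraph K).len q) := rfl
  rw [mem_preimage, himg, mem_iUnion₂]
  rcases M.exists_pt_or_vertex x with ⟨v, rfl⟩ | ⟨e, t, h0, h1, rfl⟩
  · rw [hφ.map_vertex]
    refine iff_of_false ?_ ?_
    · rintro ⟨u, hu, h⟩
      exact WeightedGraph.pt_ne_vertex hpos hu.1 hu.2 _ h
    · rintro ⟨e, -, t, ht, h⟩
      exact M.pt_ne_vertex ht.1 ht.2 _ h
  · rw [hφ.map_pt_coord h1.le, WeightedGraph.pt_mem_image_iff hpos (hM.coord_le hK h1.le) Subset.rfl]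
    constructor
    · rintro ⟨h, -⟩
      exact ⟨e, h, t, ⟨h0, h1⟩, rfl⟩
    · rintro ⟨f, hf, s, hs, h⟩
      obtain ⟨rfl, rfl⟩ := M.pt_eq_pt_of_pos_of_lt hs.2.le h0 h1 h
      exact ⟨hf, hf ▸ hM.coord_mem_Ioo hK ⟨h0, h1⟩⟩

theorem isMorphismWith [Nontrivial X] (hG' : (M.quotientGraph K).IsTropical) :
    IsMorphismWith M ((M.quotientGraph K).selfModel hG') φ
      (fun e => Nat.card (M.edgeStabilizer K e)) where
  continuous := by
    obtain ⟨ψ, hψ, hc⟩ := hM.exists_isQuotientMap hK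
    rwa [hφ.ext hψ]
  map_vertex v := ⟨_, hφ.map_vertex v⟩
  preimage_relInterior q := ⟨_, hM.preimage_relInterior hK hφ hG' q⟩
  dilation e := by
    refine ⟨fun h => absurd h Nat.card_pos.ne', fun _ => ⟨M.edgeClass K e, M.coord K e,
      fun t ht => ⟨hM.coord_le hK ht, hφ.map_pt_coord ht⟩, fun s t hs ht _ _ =>
      hM.segLength_coord hK hs ht⟩⟩

end

end IsAdmissible

end Model

end QuotientMap

/-! ### Half-edges, local degrees and the degree -/

section Harmonic

universe u

variable {X : Type u} [TopologicalSpace X] [EDist X]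

namespace Model

namespace HalfEdge

variable {M : Model X} {x : X}

/-- The germ at `t` of the half-line leaving `t` in the direction given by `b`. -/
noncomputable def side (b : Bool) (t : ℝ≥0∞) : Filter ℝ≥0∞ := if b then 𝓝[>] t else 𝓝[<] t

/-- There is room to leave the position `t` of `[0, L]` in the direction given by `b`. -/
def CanLeave (L : ℝ≥0∞) (b : Bool) (t : ℝ≥0∞) : Prop := if b then t < L else 0 < t

theorem germ_eq (h : M.HalfEdge x) : h.germ = map (M.pt h.edge) (side h.forward h.param) := rfl

theorem side_neBot {L t : ℝ≥0∞} {b : Bool} (h : CanLeave L b t) : (side b t).NeBot := by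
  cases b
  · exact nhdsLT_neBot_of_exists_lt ⟨0, h⟩
  · exact nhdsGT_neBot_of_exists_gt ⟨L, h⟩

theorem Ioo_mem_side {L t : ℝ≥0∞} {b : Bool} (ht : t ≤ L) (h : CanLeave L b t) :
    Ioo 0 L ∈ side b t := by
  cases b
  · exact mem_of_superset (Ioo_mem_nhdsLT h) (Ioo_subset_Ioo_right ht)
  · exact mem_of_superset (Ioo_mem_nhdsGT h) (Ioo_subset_Ioo_left zero_le)

theorem side_injective {t : ℝ≥0∞} {b b' : Bool} {l : Filter ℝ≥0∞} [l.NeBot] (h : l ≤ side b t)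
    (h' : l ≤ side b' t) : b = b' := by
  have key : ∀ {l : Filter ℝ≥0∞} [l.NeBot], l ≤ 𝓝[<] t → ¬ l ≤ 𝓝[>] t := by
    intro l _ h h'
    obtain ⟨s, hs, hs'⟩ := (inter_mem (h self_mem_nhdsWithin) (h' self_mem_nhdsWithin) :
      Iio t ∩ Ioi t ∈ l) |> Filter.nonempty_of_mem
    exact lt_asymm (mem_Iio.1 hs) (mem_Ioi.1 hs')
  cases b <;> cases b'
  · rfl
  · exact absurd h' (key h)
  · exact absurd h (key h')
  · rfl

theorem ext_of_edge (hloop : ∀ e, M.graph.src e ≠ M.graph.tgt e) {h₁ h₂ : M.HalfEdge x}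
    (he : h₁.edge = h₂.edge) (hf : h₁.forward = h₂.forward) : h₁ = h₂ := by
  obtain ⟨e, t, ht, hx, b, hb⟩ := h₁
  obtain ⟨f, s, hs, hx', c, hc⟩ := h₂
  dsimp only at he hf
  subst he hf
  obtain rfl := WeightedGraph.pt_injOn M.isTropical.len_pos (hloop e) ht hs
    (M.toHomeo.injective (hx.trans hx'.symm))
  rfl

/-- A germ determines its edge through interior points, and its direction because the two sides of a
parameter are disjoint; the parameter is fixed by `x` as there are no loops. Thus a half-edge tends
to at most one half-edge of the image point. -/
theorem eq_of_germ (hloop : ∀ e, M.graph.src e ≠ M.graph.tgt e) {h₁ h₂ : M.HalfEdge x}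
    {l : Filter X} [l.NeBot] (hl₁ : l ≤ h₁.germ) (hl₂ : l ≤ h₂.germ) : h₁ = h₂ := by
  have hev : ∀ h : M.HalfEdge x, l ≤ h.germ →
      ∀ P : ℝ≥0∞ → Prop, (∀ᶠ t in side h.forward h.param, P t) →
      ∀ᶠ y in l, ∃ t ∈ Ioo 0 (M.graph.len h.edge), P t ∧ M.pt h.edge t = y := by
    intro h hl P hP
    refine hl ?_
    change ∀ᶠ t in side h.forward h.param, _
    filter_upwards [hP, Ioo_mem_side h.param_le h.leaves] with t ht ht'
    exact ⟨t, ht', ht, rfl⟩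
  have key : ∀ P Q : ℝ≥0∞ → Prop, (∀ᶠ t in side h₁.forward h₁.param, P t) →
      (∀ᶠ t in side h₂.forward h₂.param, Q t) → h₁.edge = h₂.edge ∧ ∃ t, P t ∧ Q t := by
    intro P Q hP hQ
    obtain ⟨_, ⟨t, ht, hPt, rfl⟩, s, hs, hQs, hst⟩ :=
      ((hev h₁ hl₁ P hP).and (hev h₂ hl₂ Q hQ)).exists
    obtain ⟨he, rfl⟩ := M.pt_eq_pt_of_pos_of_lt hs.2.le ht.1 ht.2 hst
    exact ⟨he.symm, s, hPt, hQs⟩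
  have he := (key (fun _ => True) (fun _ => True) univ_mem univ_mem).1
  have hp : h₁.param = h₂.param := by
    refine WeightedGraph.pt_injOn M.isTropical.len_pos (hloop h₁.edge) h₁.param_le
      (he ▸ h₂.param_le) (M.toHomeo.injective ?_)
    exact h₁.pt_eq.trans (he ▸ h₂.pt_eq.symm)
  refine ext_of_edge hloop he ?_
  have : (side h₁.forward h₁.param ⊓ side h₂.forward h₁.param).NeBot := by
    refine inf_neBot_iff.2 fun {s} hs {s'} hs' => ?_
    obtain ⟨t, ht, ht'⟩ := (key (· ∈ s) (· ∈ s') hs (hp ▸ hs')).2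
    exact ⟨t, ht, ht'⟩
  exact side_injective (l := side h₁.forward h₁.param ⊓ side h₂.forward h₁.param)
    inf_le_left inf_le_right

theorem germ_neBot (h : M.HalfEdge x) : h.germ.NeBot := by
  rw [germ_eq]
  have := side_neBot h.leaves
  infer_instance

theorem nonempty [Nontrivial X] (x : X) : Nonempty (M.HalfEdge x) := by
  obtain ⟨e, t, ht, rfl⟩ := M.exists_pt x
  rcases eq_or_lt_of_le ht with rfl | h
  · exact ⟨⟨e, _, ht, rfl, false, M.isTropical.len_pos e⟩⟩
  · exact ⟨⟨e, t, ht, rfl, true, h⟩⟩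

end HalfEdge

open HalfEdge

theorem IsQuotientMap.tendsto_germ {M : Model X} {K : Subgroup (X ≃ₜ X)}
    {φ : X → (M.quotientGraph K).Curve} (hφ : M.IsQuotientMap K φ)
    {hG' : (M.quotientGraph K).IsTropical} {x : X} (h : M.HalfEdge x)
    {h' : ((M.quotientGraph K).selfModel hG').HalfEdge (φ x)} (he : M.edgeClass K h.edge = h'.edge)
    (hs : Tendsto (M.coord K h.edge) (side h.forward h.param) (side h'.forward h'.param)) :
    Tendsto φ h.germ h'.germ := by
  rw [germ_eq, germ_eq, tendsto_map'_iff, ← he]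
  refine (tendsto_map.comp hs).congr' ?_
  filter_upwards [Ioo_mem_side h.param_le h.leaves] with s hs
  exact (hφ.map_pt_coord hs.2.le).symm

namespace IsAdmissible

variable {M : Model X} {K : Subgroup (X ≃ₜ X)}

section

variable [Finite K] (hM : M.IsAdmissible K) (hK : K ≤ isometryGroup X)

include hM hK

/-- The effect of the quotient map on the direction of a half-edge. -/
theorem exists_direction_map (e : M.graph.E) : ∃ δ : Bool → Bool, Function.Involutive δ ∧
    ∀ b, ∀ t ≤ M.graph.len e,
      (CanLeave ((M.quotientGraph K).len (M.edgeClass K e)) (δ b) (M.coord K e t) ↔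
        CanLeave (M.graph.len e) b t) ∧
      (CanLeave (M.graph.len e) b t →
        Tendsto (M.coord K e) (side b t) (side (δ b) (M.coord K e t))) := by
  have hIoo : ∀ {b t}, t ≤ M.graph.len e → CanLeave (M.graph.len e) b t →
      ∀ᶠ s in side b t, s ∈ Iic (M.graph.len e) := fun ht h =>
    mem_of_superset (Ioo_mem_side ht h) fun s hs => hs.2.le
  have hcont := hM.continuous_coord hK e
  rcases hM.coord_cases hK e with H | H
  · refine ⟨id, fun _ => rfl, fun b t ht => ⟨?_, fun h => ?_⟩⟩
    · cases b
      · change 0 < M.coord K e t ↔ 0 < t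
        have := H.strictMonoOn.lt_iff_lt (mem_Iic.2 zero_le) ht
        rwa [H.coord_zero] at this
      · change M.coord K e t < _ ↔ t < M.graph.len e
        rw [← H.coord_len, H.strictMonoOn.lt_iff_lt ht self_mem_Iic]
    · cases b
      · refine tendsto_nhdsWithin_iff.2 ⟨(hcont.tendsto t).mono_left inf_le_left, ?_⟩
        filter_upwards [hIoo ht h, self_mem_nhdsWithin (a := t) (s := Iio t)] with s hs hs'
        exact H.strictMonoOn hs ht hs'
      · refine tendsto_nhdsWithin_iff.2 ⟨(hcont.tendsto t).mono_left inf_le_left, ?_⟩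
        filter_upwards [hIoo ht h, self_mem_nhdsWithin (a := t) (s := Ioi t)] with s hs hs'
        exact H.strictMonoOn ht hs hs'
  · refine ⟨not, Bool.not_not, fun b t ht => ⟨?_, fun h => ?_⟩⟩
    · cases b
      · change M.coord K e t < _ ↔ 0 < t
        rw [← H.coord_zero, H.strictAntiOn.lt_iff_gt ht (mem_Iic.2 zero_le)]
      · change 0 < M.coord K e t ↔ t < M.graph.len e
        rw [← H.coord_len, H.strictAntiOn.lt_iff_gt self_mem_Iic ht]
    · cases b
      · refine tendsto_nhdsWithin_iff.2 ⟨(hcont.tendsto t).mono_left inf_le_left, ?_⟩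
        filter_upwards [hIoo ht h, self_mem_nhdsWithin (a := t) (s := Iio t)] with s hs hs'
        exact H.strictAntiOn hs ht hs'
      · refine tendsto_nhdsWithin_iff.2 ⟨(hcont.tendsto t).mono_left inf_le_left, ?_⟩
        filter_upwards [hIoo ht h, self_mem_nhdsWithin (a := t) (s := Ioi t)] with s hs hs'
        exact H.strictAntiOn ht hs hs'

variable {φ : X → (M.quotientGraph K).Curve} (hφ : M.IsQuotientMap K φ)
  (hG' : (M.quotientGraph K).IsTropical)

include hφ

theorem exists_halfEdge_over {x : X} (h' : ((M.quotientGraph K).selfModel hG').HalfEdge (φ x))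
    {e : M.graph.E} (he : M.edgeClass K e = h'.edge) (hx : x ∈ M.edgeSet e) :
    ∃ h : M.HalfEdge x, h.edge = e ∧ Tendsto φ h.germ h'.germ := by
  -- The direction upstairs is `δ h'.forward`, since `δ` is its own inverse.
  obtain ⟨t, ht, rfl⟩ := hx
  obtain ⟨δ, hδ, H⟩ := hM.exists_direction_map hK e
  have hp : M.coord K e t = h'.param := by
    refine WeightedGraph.pt_injOn len_quotient_pos (hM.loopless_quotient (M.edgeClass K e))
      (hM.coord_le hK ht.2) (he.symm ▸ h'.param_le) ?_
    rw [← hφ.map_pt_coord ht.2, he]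
    exact h'.pt_eq.symm
  obtain ⟨H1, H2⟩ := H (δ h'.forward) t ht.2
  rw [hδ, hp] at H1 H2
  have hl := H1.1 (he ▸ h'.leaves)
  refine ⟨⟨e, t, ht.2, rfl, δ h'.forward, hl⟩, rfl, ?_⟩
  exact hφ.tendsto_germ _ he (H2 hl)

/-- The half-edge of the target computed from `coord` is a limit of the germ, and `eq_of_germ` makes
it the only one. As `δ` depends on the edge alone, a half-edge above `h'` is determined by its edge.
-/
theorem exists_direction_of_tendsto (e : M.graph.E) :
    ∃ δ : Bool → Bool, Function.Involutive δ ∧ ∀ {x : X} (h : M.HalfEdge x)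
      (h' : ((M.quotientGraph K).selfModel hG').HalfEdge (φ x)), h.edge = e →
      Tendsto φ h.germ h'.germ → M.edgeClass K e = h'.edge ∧ δ h.forward = h'.forward := by
  obtain ⟨δ, hδ, H⟩ := hM.exists_direction_map hK e
  refine ⟨δ, hδ, ?_⟩
  rintro x ⟨e, t, ht, rfl, b, hb⟩ h' rfl hh
  obtain ⟨H1, H2⟩ := H b t ht
  set h'' : ((M.quotientGraph K).selfModel hG').HalfEdge (φ (M.pt e t)) :=
    ⟨M.edgeClass K e, M.coord K e t, hM.coord_le hK ht, (hφ.map_pt_coord ht).symm, δ b, H1.2 hb⟩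
  have hh' : Tendsto φ (HalfEdge.mk e t ht rfl b hb : M.HalfEdge (M.pt e t)).germ h''.germ :=
    hφ.tendsto_germ _ rfl (H2 hb)
  have := germ_neBot (HalfEdge.mk e t ht rfl b hb : M.HalfEdge (M.pt e t))
  have heq : h'' = h' := eq_of_germ hM.loopless_quotient hh' hh
  exact ⟨congrArg HalfEdge.edge heq, congrArg HalfEdge.forward heq⟩

theorem halfEdge_eq_of_tendsto {x : X} {h₁ h₂ : M.HalfEdge x}
    {h' : ((M.quotientGraph K).selfModel hG').HalfEdge (φ x)} (hh₁ : Tendsto φ h₁.germ h'.germ)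
    (hh₂ : Tendsto φ h₂.germ h'.germ) (he : h₁.edge = h₂.edge) : h₁ = h₂ := by
  obtain ⟨δ, hδ, H⟩ := hM.exists_direction_of_tendsto hK hφ hG' h₁.edge
  refine ext_of_edge hM.loopless_edge he (hδ.injective ?_)
  rw [(H h₁ h' rfl hh₁).2, (H h₂ h' he.symm hh₂).2]

/-- The stabilizer of `x` is partitioned by the half-edge above `h'` to which an element carries a
fixed edge `e₀`. Each part is a full transporter, of order `|K_e|`, which is the dilation factor. -/
theorem localDegree_eq [Nontrivial X] (x : X)
    (h' : ((M.quotientGraph K).selfModel hG').HalfEdge (φ x)) :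
    localDegree M ((M.quotientGraph K).selfModel hG') φ
      (fun e => Nat.card (M.edgeStabilizer K e)) x h' =
      Nat.card {σ : X ≃ₜ X // σ ∈ K ∧ σ x = x} := by
  have : Finite {σ : X ≃ₜ X // σ ∈ K ∧ σ x = x} :=
    Finite.of_injective (fun σ => (⟨σ, σ.2.1⟩ : K)) fun _ _ h =>
      Subtype.ext (congrArg (fun τ : K => (τ : X ≃ₜ X)) h)
  -- Some point on an edge above `h'.edge` has the same image as `x`; an element of `K` moves it,
  -- with its edge, to `x`.
  obtain ⟨e₀, he₀, hx₀⟩ : ∃ e₀, M.edgeClass K e₀ = h'.edge ∧ x ∈ M.edgeSet e₀ := by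
    obtain ⟨e, he, t, ht, -, hy⟩ := hM.exists_edge_over hK hφ h'.param_le
    obtain ⟨σ, hσ, rfl⟩ := (hM.quotientMap_eq_iff hK hφ _ _).1 (hy.trans h'.pt_eq)
    obtain ⟨f, hf, -⟩ := hM.map_edge hK hσ e
    refine ⟨f, (edgeClass_eq_iff.2 ⟨σ, hσ, hf⟩).symm.trans he, ?_⟩
    rw [← hf]
    exact mem_image_of_mem _ ⟨t, ⟨zero_le, ht⟩, rfl⟩
  have hex : ∀ σ : {σ : X ≃ₜ X // σ ∈ K ∧ σ x = x},
      ∃ h : {h : M.HalfEdge x // Tendsto φ h.germ h'.germ},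
        (σ : X ≃ₜ X) '' M.edgeSet e₀ = M.edgeSet h.1.edge := by
    intro σ
    obtain ⟨f, hf, -⟩ := hM.map_edge hK σ.2.1 e₀
    obtain ⟨h, rfl, hh⟩ := hM.exists_halfEdge_over hK hφ hG' h' (e := f)
      ((edgeClass_eq_iff.2 ⟨σ, σ.2.1, hf⟩).symm.trans he₀)
      (hf ▸ ⟨x, hx₀, σ.2.2⟩)
    exact ⟨⟨h, hh⟩, hf⟩
  choose F hF using hex
  refine Nat.card_eq_finsum_card_fiber F _ fun h => ?_
  obtain ⟨δ, -, H⟩ := hM.exists_direction_of_tendsto hK hφ hG' h.1.edge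
  have hq := (H h.1 h' rfl h.2).1
  obtain ⟨σ₀, hσ₀, h₀⟩ := edgeClass_eq_iff.1 (he₀.trans hq.symm)
  refine (card_transporter hσ₀ h₀).trans ?_
  refine Nat.card_congr
    { toFun := fun σ => ⟨⟨σ, σ.2.1, ?_⟩, ?_⟩
      invFun := fun σ => ⟨σ.1, σ.1.2.1, ?_⟩
      left_inv := fun _ => rfl
      right_inv := fun _ => rfl }
  -- The points `σ x` and `x` lie on the same edge and have the same image, so `σ` fixes `x`
  -- automatically.
  · have hσx := mem_image_of_mem (σ : X ≃ₜ X) hx₀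
    rw [σ.2.2] at hσx
    refine hM.quotientMap_injOn_edge hK hφ h.1.edge hσx ?_ ?_
    · exact ⟨h.1.param, ⟨zero_le, h.1.param_le⟩, h.1.pt_eq⟩
    · exact ((hM.quotientMap_eq_iff hK hφ _ _).2 ⟨σ, σ.2.1, rfl⟩).symm
  · refine Subtype.ext (hM.halfEdge_eq_of_tendsto hK hφ hG' (F _).2 h.2 (M.edgeSet_injective ?_))
    exact (hF _).symm.trans σ.2.2
  · exact (hF σ.1).trans (by rw [σ.2])

theorem isFiniteHarmonicOfDegree [Nontrivial X] :
    IsFiniteHarmonicOfDegree M ((M.quotientGraph K).selfModel hG') φ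
      (fun e => Nat.card (M.edgeStabilizer K e)) (Nat.card K) where
  isMorphism := hM.isMorphismWith hK hφ hG'
  finite _ := Nat.card_pos
  harmonic x h₁ h₂ := by rw [hM.localDegree_eq hK hφ, hM.localDegree_eq hK hφ]
  degree y := by
    -- This provides a half-edge at every point of the target, so that `degreeAt` is a local degree
    -- and not the default `0`.
    have : Nontrivial (M.quotientGraph K).Curve := by
      obtain ⟨x, -⟩ := exists_pair_ne X
      obtain ⟨e, -⟩ := M.exists_pt x
      refine ⟨_, _, fun h => hM.loopless_quotient (M.edgeClass K e)
        (WeightedGraph.vertex_injective len_quotient_pos h)⟩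
    obtain ⟨x₀, rfl⟩ := hM.quotientMap_surjective hK hφ y
    have hφK : ∀ σ : K, φ ((σ : X ≃ₜ X) x₀) = φ x₀ := fun σ =>
      ((hM.quotientMap_eq_iff hK hφ _ _).2 ⟨σ, σ.2, rfl⟩).symm
    refine Nat.card_eq_finsum_card_fiber
      (fun σ : K => (⟨(σ : X ≃ₜ X) x₀, hφK σ⟩ : {x // φ x = φ x₀})) _ ?_
    rintro ⟨x, hx⟩
    rw [degreeAt, dif_pos (HalfEdge.nonempty (φ x)), hM.localDegree_eq hK hφ]
    -- The elements of `K` taking `x₀` to `σ₀ x₀` form a torsor under the stabilizer of `σ₀ x₀`,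
    -- whose order is the degree there.
    obtain ⟨σ₀, hσ₀, rfl⟩ := (hM.quotientMap_eq_iff hK hφ _ _).1 hx.symm
    refine Nat.card_congr
      { toFun := fun τ => ⟨⟨τ * σ₀, K.mul_mem τ.2.1 hσ₀⟩, Subtype.ext τ.2.2⟩
        invFun := fun σ => ⟨σ * σ₀⁻¹, K.mul_mem σ.1.2 (K.inv_mem hσ₀), ?_⟩
        left_inv := fun τ => Subtype.ext (mul_inv_cancel_right _ _)
        right_inv := fun σ => Subtype.ext (Subtype.ext (inv_mul_cancel_right _ _)) }
    have h1 : (σ₀⁻¹ : X ≃ₜ X) (σ₀ x₀) = x₀ := σ₀.symm_apply_apply x₀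
    change (σ.1 : X ≃ₜ X) ((σ₀⁻¹ : X ≃ₜ X) (σ₀ x₀)) = _
    rw [h1]
    exact congrArg Subtype.val σ.2

end

end IsAdmissible

end Model

end Harmonic

theorem mainTheorem4 {X : Type*} [TopologicalSpace X] [EDist X] (hX : IsTropicalCurve X)
    [Nontrivial X] (K : Subgroup (X ≃ₜ X)) (hK : K ≤ isometryGroup X) [Finite K] :
    (∃ M : Model X, M.IsAdmissible K) ∧
    ∀ M : Model X, M.IsAdmissible K →
      (∀ e, (M.quotientGraph K).len (M.edgeClass K e)
        = Nat.card (M.edgeStabilizer K e) * M.graph.len e) ∧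
      ∃ hG' : (M.quotientGraph K).IsTropical,
        (∃! φ : X → (M.quotientGraph K).Curve, M.IsQuotientMap K φ) ∧
        ∀ φ : X → (M.quotientGraph K).Curve, M.IsQuotientMap K φ →
          (∀ x y, φ x = φ y ↔ ∃ σ ∈ K, σ x = y) ∧
          IsFiniteHarmonicOfDegree M ((M.quotientGraph K).selfModel hG') φ
            (fun e => Nat.card (M.edgeStabilizer K e)) (Nat.card K) := by
  obtain ⟨M₀⟩ := hX
  refine ⟨M₀.exists_isAdmissible K hK, fun M hM => ⟨hM.len_edgeClass hK,
    hM.isTropical_quotient hK, ?_, fun φ hφ => ⟨hM.quotientMap_eq_iff hK hφ,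
      hM.isFiniteHarmonicOfDegree hK hφ _⟩⟩⟩
  obtain ⟨φ, hφ, -⟩ := hM.exists_isQuotientMap hK
  exact ⟨φ, hφ, fun ψ hψ => hψ.ext hφ⟩
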